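/- A multicategory consists of objects, $n$-arrows $f:\langle X_1,\dots,X_n\rangle\to X$ ($n\ge 0$), identities and an associative and unital composition $f(f_1,\dots,f_n)$. A cartesian multicategory is a multicategory $\mathbf M$ with an fp-structure: every mapping $p:\{1,\dots,n\}\to\{1,\dots,m\}$ with $X_i=X'_{p(i)}$ for all $i$ acts as a map $\mathbf M(X_1,\dots,X_n;Y)\to\mathbf M(X'_1,\dots,X'_m;Y)$, $f\mapsto pf$, functorially in $p$, with $f(p_1f_1,\dots,p_nf_n)=(p_1+\cdots+p_n)\,f(f_1,\dots,f_n)$ and $(pf)(f_1,\dots,f_m)=p'\bigl(f(f_{p1},\dots,f_{pn})\bigr)$, where $p_1+\cdots+p_n$ acts blockwise and $p'$ sends the $i$-th block identically onto the $p(i)$-th block. fp-functors are functors of multicategories that commute with these actions; they form a category $\mathrm{fpMlt}$. For a category $\mathcal C$, the multicategory $\mathcal C_\blacktriangleright$ has the objects of $\mathcal C$ and $\mathcal C_\blacktriangleright(X_1,\dots,X_n;X)=\mathcal C(X_1,X)\times\cdots\times\mathcal C(X_n,X)$, with composition $\bigl(\langle\lambda_i\rangle_i\bigr)\bigl(\langle\alpha_{1l}\rangle_l,\dots,\langle\alpha_{nl}\rangle_l\bigr)=\langle\lambda_i\alpha_{il}\rangle_{i,l}$.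 A multicategory is representable if every finite sequence of objects is the domain of a pre-universal arrow $u:\langle X_1,\dots,X_n\rangle\to T$ (one for which $f\mapsto f(u)$ is a bijection $\mathbf M(T;Z)\to\mathbf M(X_1,\dots,X_n;Z)$ for all $Z$) and pre-universal arrows are closed under composition. Let $\mathrm{fpSum}\subset\mathrm{fpMlt}$ be the full subcategory of those cartesian multicategories whose underlying multicategory is representable and isomorphic to $\mathcal C_\blacktriangleright$ for some category $\mathcal C$. "Preadditive" and "additive functor" mean enriched in commutative monoids. For $\mathcal C$ preadditive, $\mathcal C_\blacktriangleright$ is a cartesian multicategory, the $j$-th component of $p\langle f_1,\dots,f_n\rangle$ being $\sum_{p(i)=j}f_i$. For $\mathcal C$ with finite products, $\mathcal C_\times$ is the cartesian multicategory with $\mathcal C_\times(X_1,\dots,X_n;X)=\mathcal C(X_1\times\cdots\times X_n,X)$, mappings acting by composition with the induced maps between products (diagonals, projections, exchanges). These assignments are functors on preadditive categories and additive functors, and on finite product categories and finite product preserving functors, respectively. Theorem. (1) $\mathcal C\mapsto\mathcal C_\blacktriangleright$ restricts to an equivalence from the category of preadditive categories with finite sums (coproducts) and additive functors onto $\mathrm{fpSum}$.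 (2) $\mathcal C\mapsto\mathcal C_\times$ restricts to an equivalence onto $\mathrm{fpSum}$ from the category whose objects are the categories with finite sums and finite products for which there is some isomorphism $X+Y\cong X\times Y$ natural in $X$ and $Y$, and whose morphisms are the finite product preserving functors. (3) Consequently, for a category $\mathcal C$ the following are equivalent: $\mathcal C$ admits a preadditive structure and has finite biproducts with respect to it; $\mathcal C$ admits a preadditive structure and has finite sums; $\mathcal C$ has finite sums and finite products and an isomorphism $X+Y\cong X\times Y$ natural in $X$ and $Y$. For a functor between preadditive categories with finite sums, the following are equivalent: it is additive; it preserves finite biproducts; it preserves finite products; it preserves finite sums. -/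

import Mathlib

universe v u

open CategoryTheory CategoryTheory.Limits

namespace CartMulti

/-! ### Blocks of indices

The canonical (lexicographic) enumeration of the pairs `(i, l)` with `i : Fin n`, `l : Fin (k i)`
is Mathlib's `finSigmaFinEquiv`. -/

/-- Concatenation of the finite sequences `X 0, X 1, …, X (n-1)`. -/
abbrev concat {Ob : Type u} {n : ℕ} {k : Fin n → ℕ} (X : ∀ i, Fin (k i) → Ob) :
    Fin (∑ i, k i) → Ob :=
  fun j => X (finSigmaFinEquiv.symm j).1 (finSigmaFinEquiv.symm j).2

/-- The sum `p 0 + ⋯ + p (n-1)` of mappings, acting blockwise. -/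
def sumMap {n : ℕ} {k k' : Fin n → ℕ} (p : ∀ i, Fin (k i) → Fin (k' i)) :
    Fin (∑ i, k i) → Fin (∑ i, k' i) :=
  fun j => finSigmaFinEquiv
    ⟨(finSigmaFinEquiv.symm j).1, p (finSigmaFinEquiv.symm j).1 (finSigmaFinEquiv.symm j).2⟩

/-- The mapping which sends the `i`-th block (of length `k (p i)`) identically
onto the `p i`-th block. -/
def blockMap {n m : ℕ} (p : Fin n → Fin m) (k : Fin m → ℕ) :
    Fin (∑ i, k (p i)) → Fin (∑ j, k j) :=
  fun j => finSigmaFinEquiv ⟨p (finSigmaFinEquiv.symm j).1, (finSigmaFinEquiv.symm j).2⟩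

theorem concat_apply {Ob : Type u} {n : ℕ} {k : Fin n → ℕ} (X : ∀ i, Fin (k i) → Ob)
    (s : Σ i, Fin (k i)) : concat X (finSigmaFinEquiv s) = X s.1 s.2 :=
  congrArg (fun s : Σ i, Fin (k i) => X s.1 s.2) (finSigmaFinEquiv.symm_apply_apply s)

theorem concat_sumMap {Ob : Type u} {n : ℕ} {k k' : Fin n → ℕ}
    (p : ∀ i, Fin (k i) → Fin (k' i)) {X : ∀ i, Fin (k i) → Ob} {X' : ∀ i, Fin (k' i) → Ob}
    (h : ∀ i l, X i l = X' i (p i l)) (j : Fin (∑ i, k i)) :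
    concat X j = concat X' (sumMap p j) :=
  (h _ _).trans (concat_apply X' ⟨(finSigmaFinEquiv.symm j).1,
    p (finSigmaFinEquiv.symm j).1 (finSigmaFinEquiv.symm j).2⟩).symm

theorem concat_blockMap {Ob : Type u} {n m : ℕ} (p : Fin n → Fin m) {k : Fin m → ℕ}
    (X : ∀ j, Fin (k j) → Ob) (j : Fin (∑ i, k (p i))) :
    concat (fun i => X (p i)) j = concat X (blockMap p k j) :=
  (concat_apply X ⟨p (finSigmaFinEquiv.symm j).1, (finSigmaFinEquiv.symm j).2⟩).symm

theorem block_lt_aux {n : ℕ} {k : Fin n → ℕ} (a b : Σ i, Fin (k i)) (h : a.1 < b.1) :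
    finSigmaFinEquiv a < finSigmaFinEquiv b := by
  have key : ∀ (i j : ℕ) (hj : j < n) (hij : i < j),
      (∑ x : Fin i, k (Fin.castLE (hij.trans hj).le x)) + k ⟨i, hij.trans hj⟩ ≤
        ∑ x : Fin j, k (Fin.castLE hj.le x) := by
    intro i j hj hij
    have e1 : (∑ x : Fin i, k (Fin.castLE (hij.trans hj).le x)) + k ⟨i, hij.trans hj⟩ =
        ∑ x : Fin (i + 1), k (Fin.castLE (by omega) x) := by
      rw [Fin.sum_univ_castSucc]; rfl
    rw [e1]
    obtain ⟨d, rfl⟩ := Nat.exists_eq_add_of_le (Nat.succ_le_of_lt hij)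
    exact (Nat.le_add_right _ _).trans
      (Fin.sum_univ_add (fun x : Fin (i.succ + d) => k (Fin.castLE hj.le x))).ge
  rw [Fin.lt_def, finSigmaFinEquiv_apply, finSigmaFinEquiv_apply]
  have := key a.1 b.1 b.1.2 h
  have h2 := a.2.2
  have e : k ⟨a.1, (Fin.lt_def.1 h).trans b.1.2⟩ = k a.1 := rfl
  omega

theorem block_lt_iff {n : ℕ} {k : Fin n → ℕ} (a b : Σ i, Fin (k i)) :
    finSigmaFinEquiv a < finSigmaFinEquiv b ↔
      a.1 < b.1 ∨ (a.1 = b.1 ∧ (a.2 : ℕ) < b.2) := by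
  rcases lt_trichotomy a.1 b.1 with h | h | h
  · simp [h, block_lt_aux a b h]
  · obtain ⟨i, l⟩ := a
    obtain ⟨i', l'⟩ := b
    obtain rfl : i = i' := h
    rw [Fin.lt_def, finSigmaFinEquiv_apply, finSigmaFinEquiv_apply]
    simp
  · have := block_lt_aux b a h
    simp only [not_lt_of_gt this, false_iff, not_or, not_and]
    exact ⟨not_lt_of_gt h, fun h' => absurd h' h.ne'⟩

theorem val_eq_of_lt_iff {A : Type*} {N N' : ℕ} (f : A → Fin N) (g : A → Fin N')
    (hf : Function.Surjective f) (hg : Function.Surjective g)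
    (h : ∀ a b, f a < f b ↔ g a < g b) (a : A) : (f a : ℕ) = g a := by
  have hfg : ∀ a b, f a = f b → g a = g b := fun a b e =>
    le_antisymm (not_lt.1 fun l => ((h _ _).2 l).ne e.symm)
      (not_lt.1 fun l => ((h _ _).2 l).ne e)
  have hmono : StrictMono (fun J => g (Function.surjInv hf J)) := by
    intro J J' hJ
    rw [← Function.surjInv_eq hf J, ← Function.surjInv_eq hf J'] at hJ
    exact (h _ _).1 hJ
  have hsurj : Function.Surjective (fun J => g (Function.surjInv hf J)) := by
    intro J
    obtain ⟨b, rfl⟩ := hg J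
    exact ⟨f b, hfg _ _ (Function.surjInv_eq hf (f b))⟩
  have := Fin.coe_orderIso_apply (StrictMono.orderIsoOfSurjective _ hmono hsurj) (f a)
  rw [← this]
  exact congrArg Fin.val (hfg _ _ (Function.surjInv_eq hf (f a)))

/-- The two ways of enumerating iterated blocks agree. -/
theorem block_assoc {n : ℕ} {k : Fin n → ℕ} (m : ∀ i, Fin (k i) → ℕ)
    (s : Σ a : (Σ i, Fin (k i)), Fin (m a.1 a.2)) :
    (finSigmaFinEquiv (⟨finSigmaFinEquiv s.1, Fin.cast (concat_apply m s.1).symm s.2⟩ :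
        Σ j, Fin (concat m j)) : ℕ) =
      (finSigmaFinEquiv (⟨s.1.1, finSigmaFinEquiv ⟨s.1.2, s.2⟩⟩ :
        Σ i, Fin (∑ l, m i l)) : ℕ) := by
  refine val_eq_of_lt_iff
    (fun s : Σ a : (Σ i, Fin (k i)), Fin (m a.1 a.2) => finSigmaFinEquiv
      (⟨finSigmaFinEquiv s.1, Fin.cast (concat_apply m s.1).symm s.2⟩ : Σ j, Fin (concat m j)))
    (fun s => finSigmaFinEquiv
      (⟨s.1.1, finSigmaFinEquiv ⟨s.1.2, s.2⟩⟩ : Σ i, Fin (∑ l, m i l))) ?_ ?_ ?_ s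
  · intro J
    obtain ⟨⟨a, x⟩, rfl⟩ := finSigmaFinEquiv.surjective J
    obtain ⟨a, rfl⟩ := finSigmaFinEquiv.surjective a
    exact ⟨⟨a, Fin.cast (concat_apply m a) x⟩, rfl⟩
  · intro J
    obtain ⟨⟨a, x⟩, rfl⟩ := finSigmaFinEquiv.surjective J
    obtain ⟨⟨b, y⟩, rfl⟩ := finSigmaFinEquiv.surjective x
    exact ⟨⟨⟨a, b⟩, y⟩, rfl⟩
  · rintro ⟨⟨a, b⟩, x⟩ ⟨⟨a', b'⟩, x'⟩
    rw [block_lt_iff, block_lt_iff, block_lt_iff]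
    constructor
    · rintro ((h | ⟨rfl, h⟩) | ⟨h, h'⟩)
      · exact Or.inl h
      · exact Or.inr ⟨rfl, Fin.lt_def.1 ((block_lt_iff (k := m a) ⟨b, x⟩ ⟨b', x'⟩).2
          (Or.inl h))⟩
      · obtain ⟨rfl, h⟩ := Sigma.mk.inj_iff.1 (finSigmaFinEquiv.injective h)
        obtain rfl := eq_of_heq h
        exact Or.inr ⟨rfl, Fin.lt_def.1 ((block_lt_iff (k := m a) ⟨b, x⟩ ⟨b, x'⟩).2
          (Or.inr ⟨rfl, h'⟩))⟩
    · rintro (h | ⟨rfl, h⟩)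
      · exact Or.inl (Or.inl h)
      · rcases (block_lt_iff (k := m a) ⟨b, x⟩ ⟨b', x'⟩).1 (Fin.lt_def.2 h) with h | ⟨h, h'⟩
        · exact Or.inl (Or.inr ⟨rfl, h⟩)
        · obtain rfl : b = b' := h
          exact Or.inr ⟨rfl, h'⟩

theorem block_count {n : ℕ} {k : Fin n → ℕ} (m : ∀ i, Fin (k i) → ℕ) :
    ∑ j, concat m j = ∑ i, ∑ l, m i l := by
  rw [← Equiv.sum_comp finSigmaFinEquiv (concat m), Fintype.sum_sigma]
  exact Finset.sum_congr rfl fun i _ => Finset.sum_congr rfl fun l _ => concat_apply m ⟨i, l⟩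

theorem block_assoc_symm {n : ℕ} {k : Fin n → ℕ} (m : ∀ i, Fin (k i) → ℕ)
    (J : Fin (∑ j, concat m j)) (J' : Fin (∑ i, ∑ l, m i l)) (hJ : (J : ℕ) = J') :
    (⟨finSigmaFinEquiv.symm (finSigmaFinEquiv.symm J).1, (finSigmaFinEquiv.symm J).2⟩ :
      Σ a : (Σ i, Fin (k i)), Fin (m a.1 a.2)) =
    ⟨⟨(finSigmaFinEquiv.symm J').1, (finSigmaFinEquiv.symm (finSigmaFinEquiv.symm J').2).1⟩,
      (finSigmaFinEquiv.symm (finSigmaFinEquiv.symm J').2).2⟩ := by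
  obtain ⟨x, rfl⟩ := finSigmaFinEquiv.surjective J'
  obtain ⟨i, x⟩ := x
  obtain ⟨⟨l, t⟩, rfl⟩ := finSigmaFinEquiv.surjective x
  have h := block_assoc m ⟨⟨i, l⟩, t⟩
  obtain rfl := Fin.ext (hJ.trans h.symm)
  have hn : concat m (finSigmaFinEquiv ⟨i, l⟩) = m i l := concat_apply m ⟨i, l⟩
  let A : (Σ j, Fin (concat m j)) → Σ a : (Σ i, Fin (k i)), Fin (m a.1 a.2) :=
    fun x => ⟨finSigmaFinEquiv.symm x.1, x.2⟩
  let B : (Σ i, Fin (∑ l, m i l)) → Σ a : (Σ i, Fin (k i)), Fin (m a.1 a.2) :=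
    fun x => ⟨⟨x.1, (finSigmaFinEquiv.symm x.2).1⟩, (finSigmaFinEquiv.symm x.2).2⟩
  have hA : A ⟨finSigmaFinEquiv ⟨i, l⟩, Fin.cast hn.symm t⟩ = ⟨⟨i, l⟩, t⟩ :=
    Sigma.ext (Equiv.symm_apply_apply _ _) ((Fin.heq_ext_iff hn).2 rfl)
  have hB : B ⟨i, finSigmaFinEquiv ⟨l, t⟩⟩ = ⟨⟨i, l⟩, t⟩ :=
    congrArg (fun y : Σ l, Fin (m i l) =>
      (⟨⟨i, y.1⟩, y.2⟩ : Σ a : (Σ i, Fin (k i)), Fin (m a.1 a.2)))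
      (Equiv.symm_apply_apply finSigmaFinEquiv ⟨l, t⟩)
  exact ((congrArg A (Equiv.symm_apply_apply _ _)).trans hA).trans
    ((congrArg B (Equiv.symm_apply_apply _ _)).trans hB).symm

/-! ### Multicategories -/

/-- A multicategory. The domain of an `n`-arrow is a sequence `Fin n → Ob`.
The two sides of each law are `n`-arrows whose domains are (propositionally) the same sequence;
the laws are heterogeneous equalities, that is, equalities up to transport
along this equality of domains. -/
structure Multicat where
  Ob : Type u
  Hom : ∀ {n : ℕ}, (Fin n → Ob) → Ob → Type v
  id : ∀ X : Ob, Hom (fun _ : Fin 1 => X) X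
  comp : ∀ {n : ℕ} {Y : Fin n → Ob} {Z : Ob} {k : Fin n → ℕ} {X : ∀ i, Fin (k i) → Ob},
    Hom Y Z → (∀ i, Hom (X i) (Y i)) → Hom (concat X) Z
  id_comp : ∀ {n : ℕ} {X : Fin n → Ob} {Y : Ob} (f : Hom X Y),
    HEq (comp (id Y) (fun _ : Fin 1 => f)) f
  comp_id : ∀ {n : ℕ} {X : Fin n → Ob} {Y : Ob} (f : Hom X Y),
    HEq (comp f (fun i => id (X i))) f
  assoc : ∀ {n : ℕ} {W : Fin n → Ob} {Z : Ob} {k : Fin n → ℕ} {Y : ∀ i, Fin (k i) → Ob}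
    {m : ∀ i, Fin (k i) → ℕ} {X : ∀ i l, Fin (m i l) → Ob}
    (f : Hom W Z) (g : ∀ i, Hom (Y i) (W i)) (h : ∀ i l, Hom (X i l) (Y i l)),
    HEq (comp (k := concat m) (comp f g)
        (fun j => h (finSigmaFinEquiv.symm j).1 (finSigmaFinEquiv.symm j).2))
      (comp f (fun i => comp (g i) (h i)))

/-- Functors of multicategories. -/
@[ext]
structure Multifunctor (M N : Multicat.{v, u}) where
  obj : M.Ob → N.Ob
  map : ∀ {n : ℕ} {X : Fin n → M.Ob} {Y : M.Ob},
    M.Hom X Y → N.Hom (fun i => obj (X i)) (obj Y)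
  map_id : ∀ X : M.Ob, map (M.id X) = N.id (obj X)
  map_comp : ∀ {n : ℕ} {Y : Fin n → M.Ob} {Z : M.Ob} {k : Fin n → ℕ}
    {X : ∀ i, Fin (k i) → M.Ob} (f : M.Hom Y Z) (g : ∀ i, M.Hom (X i) (Y i)),
    map (M.comp f g) = N.comp (map f) (fun i => map (g i))

/-- The category of multicategories. -/
instance : Category Multicat.{v, u} where
  Hom M N := Multifunctor M N
  id M := ⟨fun X => X, fun f => f, fun _ => rfl, fun _ _ => rfl⟩
  comp F G := ⟨fun X => G.obj (F.obj X), fun f => G.map (F.map f),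
    fun X => (congrArg G.map (F.map_id X)).trans (G.map_id _),
    fun f g => (congrArg G.map (F.map_comp f g)).trans (G.map_comp _ _)⟩

/-- `t : X₁, …, Xₙ → T` is pre-universal if composing with it gives bijections
`M(T; Z) → M(X₁, …, Xₙ; Z)`. -/
def Multicat.PreUniversal (M : Multicat.{v, u}) {n : ℕ} {X : Fin n → M.Ob} {T : M.Ob}
    (t : M.Hom X T) : Prop :=
  ∀ Z : M.Ob, Function.Bijective
    (fun f : M.Hom (fun _ : Fin 1 => T) Z => M.comp f (fun _ : Fin 1 => t))

/-- A multicategory is representable if every finite sequence of objects is the domain of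
a pre-universal arrow and pre-universal arrows are closed under composition. -/
structure Multicat.IsRepresentable (M : Multicat.{v, u}) : Prop where
  exists_preUniversal : ∀ {n : ℕ} (X : Fin n → M.Ob), ∃ (T : M.Ob) (t : M.Hom X T),
    M.PreUniversal t
  comp_preUniversal : ∀ {n : ℕ} {Y : Fin n → M.Ob} {Z : M.Ob} {k : Fin n → ℕ}
    {X : ∀ i, Fin (k i) → M.Ob} (f : M.Hom Y Z) (g : ∀ i, M.Hom (X i) (Y i)),
    M.PreUniversal f → (∀ i, M.PreUniversal (g i)) → M.PreUniversal (M.comp f g)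

/-! ### Cartesian multicategories -/

/-- A cartesian multicategory: a multicategory with an fp-structure. A morphism
`(n, X) ⟶ (m, X')` of the comma category of finite sequences of objects is a mapping
`p : Fin n → Fin m` with `X i = X' (p i)` for all `i`; such morphisms act functorially
on arrows with fixed codomain, compatibly with composition. -/
structure CartMulticat extends Multicat.{v, u} where
  act : ∀ {n m : ℕ} (p : Fin n → Fin m) {X : Fin n → Ob} {X' : Fin m → Ob}
    (_ : ∀ i, X i = X' (p i)) {Y : Ob}, Hom X Y → Hom X' Y
  act_id : ∀ {n : ℕ} {X : Fin n → Ob} {Y : Ob} (f : Hom X Y),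
    act (fun i => i) (fun _ => rfl) f = f
  act_comp : ∀ {n m r : ℕ} (p : Fin n → Fin m) (q : Fin m → Fin r) {X : Fin n → Ob}
    {X' : Fin m → Ob} {X'' : Fin r → Ob} (hp : ∀ i, X i = X' (p i))
    (hq : ∀ i, X' i = X'' (q i)) {Y : Ob} (f : Hom X Y),
    act (fun i => q (p i)) (fun i => (hp i).trans (hq (p i))) f = act q hq (act p hp f)
  comp_act : ∀ {n : ℕ} {Y : Fin n → Ob} {Z : Ob} {k k' : Fin n → ℕ}
    {X : ∀ i, Fin (k i) → Ob} {X' : ∀ i, Fin (k' i) → Ob}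
    (p : ∀ i, Fin (k i) → Fin (k' i)) (hp : ∀ i l, X i l = X' i (p i l))
    (f : Hom Y Z) (g : ∀ i, Hom (X i) (Y i)),
    comp f (fun i => act (p i) (hp i) (g i)) = act (sumMap p) (concat_sumMap p hp) (comp f g)
  act_comp_eq : ∀ {n m : ℕ} (p : Fin n → Fin m) {Y : Fin m → Ob} {Z : Ob} {k : Fin m → ℕ}
    {X : ∀ j, Fin (k j) → Ob} (f : Hom (fun i => Y (p i)) Z) (g : ∀ j, Hom (X j) (Y j)),
    comp (act p (fun _ => rfl) f) g =
      act (blockMap p k) (concat_blockMap p X) (comp f (fun i => g (p i)))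

/-- Functors of cartesian multicategories (fp-functors). -/
@[ext]
structure FpFunctor (M N : CartMulticat.{v, u}) extends
    Multifunctor M.toMulticat N.toMulticat where
  map_act : ∀ {n m : ℕ} (p : Fin n → Fin m) {X : Fin n → M.Ob} {X' : Fin m → M.Ob}
    (h : ∀ i, X i = X' (p i)) {Y : M.Ob} (f : M.Hom X Y),
    map (M.act p h f) = N.act p (fun i => congrArg obj (h i)) (map f)

/-- The category of cartesian multicategories. -/
instance : Category CartMulticat.{v, u} where
  Hom M N := FpFunctor M N
  id M := ⟨𝟙 M.toMulticat, fun _ _ _ _ _ _ => rfl⟩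
  comp {L M N} F G := ⟨(show L.toMulticat ⟶ M.toMulticat from F.toMultifunctor) ≫
      (show M.toMulticat ⟶ N.toMulticat from G.toMultifunctor), by
    intro n m p X X' h Y f
    change G.map (F.map _) = N.act p _ (G.map (F.map f))
    rw [F.map_act, G.map_act]⟩

/-- The underlying functor from cartesian multicategories to multicategories. -/
def underlying : CartMulticat.{v, u} ⥤ Multicat.{v, u} where
  obj M := M.toMulticat
  map F := F.toMultifunctor

/-! ### The discrete cocone multicategory of a category -/

theorem heq_cone {C : Type u} [Category.{v} C] {Y : C} {n m : ℕ} {X : Fin n → C}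
    {X' : Fin m → C} (h : n = m) (hX : ∀ i, X i = X' (Fin.cast h i))
    (f : ∀ i, X i ⟶ Y) (g : ∀ i, X' i ⟶ Y) (H : ∀ i, HEq (f i) (g (Fin.cast h i))) :
    HEq f g := by
  subst h
  obtain rfl : X = X' := funext hX
  exact heq_of_eq (funext fun i => eq_of_heq (H i))

/-- The discrete cocone multicategory `C_▸`: an arrow `X₁, …, Xₙ → Y` is a sequence of arrows
`Xᵢ ⟶ Y` in `C`. -/
def cone (C : Type u) [Category.{v} C] : Multicat.{v, u} where
  Ob := C
  Hom {n} X Y := ∀ i : Fin n, X i ⟶ Y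
  id X := fun _ => 𝟙 X
  comp f g := fun j => g (finSigmaFinEquiv.symm j).1 (finSigmaFinEquiv.symm j).2 ≫
    f (finSigmaFinEquiv.symm j).1
  id_comp {n X Y} f := by
    have e : ∀ j : Fin (∑ _ : Fin 1, n), (finSigmaFinEquiv.symm j).2 =
        Fin.cast (by simp) j := by
      intro j
      obtain ⟨s, rfl⟩ := finSigmaFinEquiv.surjective j
      ext
      rw [Equiv.symm_apply_apply, Fin.val_cast, finSigmaFinEquiv_one]
    refine heq_cone (by simp) (fun j => congrArg X (e j)) _ _ fun j => ?_
    exact (heq_of_eq (Category.comp_id _)).trans (congr_arg_heq f (e j))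
  comp_id {n X Y} f := by
    have e : ∀ j : Fin (∑ _ : Fin n, 1), (finSigmaFinEquiv.symm j).1 =
        Fin.cast (by simp) j := by
      intro j
      obtain ⟨s, rfl⟩ := finSigmaFinEquiv.surjective j
      ext
      rw [Equiv.symm_apply_apply, Fin.val_cast, finSigmaFinEquiv_apply]
      simp
    refine heq_cone (by simp) (fun j => congrArg X (e j)) _ _ fun j => ?_
    exact (heq_of_eq (Category.id_comp _)).trans (congr_arg_heq f (e j))
  assoc {n W Z k Y m X} f g h := by
    let φ : ∀ s : (Σ a : (Σ i, Fin (k i)), Fin (m a.1 a.2)), X s.1.1 s.1.2 s.2 ⟶ Z :=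
      fun s => h s.1.1 s.1.2 s.2 ≫ g s.1.1 s.1.2 ≫ f s.1.1
    have e := fun J => block_assoc_symm m J (Fin.cast (block_count m) J) rfl
    refine heq_cone (block_count m) (fun J => congrArg
      (fun s : (Σ a : (Σ i, Fin (k i)), Fin (m a.1 a.2)) => X s.1.1 s.1.2 s.2) (e J)) _ _
      fun J => ?_
    exact HEq.trans (congr_arg_heq φ (e J)) (heq_of_eq (Category.assoc _ _ _).symm)

/-! ### Preadditive categories (enriched in commutative monoids) -/

/-- An enrichment of a category in commutative monoids. -/
class CMonEnriched (C : Type u) [Category.{v} C] where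
  addCommMonoid : ∀ X Y : C, AddCommMonoid (X ⟶ Y)
  add_comp : ∀ {X Y Z : C} (f f' : X ⟶ Y) (g : Y ⟶ Z), (f + f') ≫ g = f ≫ g + f' ≫ g
  comp_add : ∀ {X Y Z : C} (f : X ⟶ Y) (g g' : Y ⟶ Z), f ≫ (g + g') = f ≫ g + f ≫ g'
  zero_comp : ∀ {X Y Z : C} (g : Y ⟶ Z), (0 : X ⟶ Y) ≫ g = 0
  comp_zero : ∀ {X Y Z : C} (f : X ⟶ Y), f ≫ (0 : Y ⟶ Z) = 0

attribute [reducible, instance] CMonEnriched.addCommMonoid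

/-- The zero morphisms of a category enriched in commutative monoids. -/
instance CMonEnriched.hasZeroMorphisms (C : Type u) [Category.{v} C] [CMonEnriched C] :
    HasZeroMorphisms C where
  zero X Y := ⟨(0 : X ⟶ Y)⟩
  comp_zero f _ := CMonEnriched.comp_zero f
  zero_comp _ _ _ g := CMonEnriched.zero_comp g

/-- Additive functors: functors enriched in commutative monoids. -/
structure IsAdditive {C D : Type u} [Category.{v} C] [Category.{v} D] [CMonEnriched C]
    [CMonEnriched D] (F : C ⥤ D) : Prop where
  map_zero : ∀ X Y : C, F.map (0 : X ⟶ Y) = 0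
  map_add : ∀ {X Y : C} (f g : X ⟶ Y), F.map (f + g) = F.map f + F.map g

/-- Bundled preadditive categories. -/
structure CMonCat where
  carrier : Type u
  [category : Category.{v} carrier]
  [enriched : CMonEnriched carrier]

attribute [instance] CMonCat.category CMonCat.enriched

/-- The category of preadditive categories and additive functors. -/
instance : Category CMonCat.{v, u} where
  Hom C D := {F : C.carrier ⥤ D.carrier // IsAdditive F}
  id C := ⟨𝟭 _, ⟨fun _ _ => rfl, fun _ _ => rfl⟩⟩
  comp F G := ⟨F.1 ⋙ G.1,
    ⟨fun X Y => by simp [F.2.map_zero, G.2.map_zero],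
     fun f g => by simp [F.2.map_add, G.2.map_add]⟩⟩

theorem sum_comp {C : Type u} [Category.{v} C] [CMonEnriched C] {X Y Z : C} {ι : Type}
    (s : Finset ι) (f : ι → (X ⟶ Y)) (g : Y ⟶ Z) :
    (∑ i ∈ s, f i) ≫ g = ∑ i ∈ s, f i ≫ g := by
  classical
  induction s using Finset.induction_on with
  | empty => simp
  | insert a s ha ih => rw [Finset.sum_insert ha, Finset.sum_insert ha, CMonEnriched.add_comp, ih]

theorem comp_sum {C : Type u} [Category.{v} C] [CMonEnriched C] {X Y Z : C} {ι : Type}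
    (s : Finset ι) (f : X ⟶ Y) (g : ι → (Y ⟶ Z)) :
    f ≫ (∑ i ∈ s, g i) = ∑ i ∈ s, f ≫ g i := by
  classical
  induction s using Finset.induction_on with
  | empty => simp
  | insert a s ha ih => rw [Finset.sum_insert ha, Finset.sum_insert ha, CMonEnriched.comp_add, ih]

section Cone

theorem eqToHom_congr {C : Type u} [Category.{v} C] {ι : Type} {X : ι → C} {Y Z : C} (φ : ∀ i, X i ⟶ Y) {i j : ι} (h : i = j)
    (hi : Z = X i) (hj : Z = X j) : eqToHom hi ≫ φ i = eqToHom hj ≫ φ j := by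
  subst h; rfl

variable {C : Type u} [Category.{v} C] [CMonEnriched C]

/-- The action of a mapping `p` on a sequence of concurrent arrows: the `j`-th component of `p f`
is the sum of the components `f i` with `p i = j` (zero if there is none). -/
def coneAct {n m : ℕ} (p : Fin n → Fin m) {X : Fin n → C} {X' : Fin m → C}
    (h : ∀ i, X i = X' (p i)) {Y : C} (f : ∀ i, X i ⟶ Y) (j : Fin m) : X' j ⟶ Y :=
  ∑ i : {i : Fin n // p i = j}, eqToHom ((congrArg X' i.2).symm.trans (h i).symm) ≫ f i

theorem coneAct_id_aux {n : ℕ} {X : Fin n → C} {Y : C} (p : Fin n → Fin n)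
    (hp : ∀ i, p i = i) (h : ∀ i, X i = X (p i)) (f : ∀ i, X i ⟶ Y) :
    coneAct p h f = f := by
  funext j
  unfold coneAct
  refine (Finset.sum_eq_single_of_mem ⟨j, hp j⟩ (Finset.mem_univ _)
    (fun i _ hi => absurd (Subtype.ext ((hp i.1).symm.trans i.2)) hi)).trans ?_
  simp

theorem coneAct_id {n : ℕ} {X : Fin n → C} {Y : C} (f : ∀ i, X i ⟶ Y) :
    coneAct (fun i => i) (fun _ => rfl) f = f :=
  coneAct_id_aux _ (fun _ => rfl) _ f

theorem coneAct_comp {n m r : ℕ} (p : Fin n → Fin m) (q : Fin m → Fin r) {X : Fin n → C}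
    {X' : Fin m → C} {X'' : Fin r → C} (hp : ∀ i, X i = X' (p i))
    (hq : ∀ i, X' i = X'' (q i)) {Y : C} (f : ∀ i, X i ⟶ Y) :
    coneAct (fun i => q (p i)) (fun i => (hp i).trans (hq (p i))) f =
      coneAct q hq (coneAct p hp f) := by
  funext j
  unfold coneAct
  simp only [comp_sum]
  rw [← Fintype.sum_sigma']
  symm
  refine Fintype.sum_bijective (fun x => ⟨x.2.1, by rw [x.2.2, x.1.2]⟩) ⟨?_, ?_⟩ _ _ ?_
  · rintro ⟨⟨a, ha⟩, ⟨b, hb⟩⟩ ⟨⟨a', ha'⟩, ⟨b', hb'⟩⟩ h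
    obtain rfl : b = b' := congrArg Subtype.val h
    obtain rfl : p b = a := hb
    obtain rfl : p b = a' := hb'
    rfl
  · rintro ⟨i, hi⟩
    exact ⟨⟨⟨p i, hi⟩, ⟨i, rfl⟩⟩, rfl⟩
  · rintro ⟨⟨a, ha⟩, ⟨b, hb⟩⟩
    simp

theorem cone_comp_act {n : ℕ} {Y : Fin n → C} {Z : C} {k k' : Fin n → ℕ}
    {X : ∀ i, Fin (k i) → C} {X' : ∀ i, Fin (k' i) → C}
    (p : ∀ i, Fin (k i) → Fin (k' i)) (hp : ∀ i l, X i l = X' i (p i l))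
    (f : ∀ i, Y i ⟶ Z) (g : ∀ i l, X i l ⟶ Y i) :
    (cone C).comp (X := X') f (fun i => coneAct (p i) (hp i) (g i)) =
      coneAct (sumMap p) (concat_sumMap p hp) ((cone C).comp (X := X) f g) := by
  funext j
  change (∑ x : {x // p (finSigmaFinEquiv.symm j).1 x = (finSigmaFinEquiv.symm j).2}, _) ≫ _ =
    ∑ J : {J // sumMap p J = j}, eqToHom _ ≫ (g (finSigmaFinEquiv.symm J.1).1
      (finSigmaFinEquiv.symm J.1).2 ≫ f (finSigmaFinEquiv.symm J.1).1)
  rw [sum_comp]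
  refine Fintype.sum_bijective (fun x => ⟨finSigmaFinEquiv ⟨(finSigmaFinEquiv.symm j).1, x.1⟩, ?h⟩)
    ⟨?_, ?_⟩ _ _ ?_
  case h =>
    rw [sumMap, ← Equiv.eq_symm_apply]
    refine (congrArg (fun t : Σ i, Fin (k i) => (⟨t.1, p t.1 t.2⟩ : Σ i, Fin (k' i)))
      (Equiv.symm_apply_apply finSigmaFinEquiv ⟨(finSigmaFinEquiv.symm j).1, x.1⟩)).trans ?_
    exact Sigma.ext rfl (heq_of_eq x.2)
  · rintro ⟨a, ha⟩ ⟨b, hb⟩ h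
    have := finSigmaFinEquiv.injective (congrArg Subtype.val h)
    exact Subtype.ext (eq_of_heq (Sigma.mk.inj this).2)
  · rintro ⟨J, hJ⟩
    obtain ⟨⟨i, x⟩, rfl⟩ := finSigmaFinEquiv.surjective J
    have e : finSigmaFinEquiv.symm j = ⟨i, p i x⟩ := by
      rw [← hJ, sumMap, Equiv.symm_apply_apply]
      exact congrArg (fun t : Σ i, Fin (k i) => (⟨t.1, p t.1 t.2⟩ : Σ i, Fin (k' i)))
        (Equiv.symm_apply_apply finSigmaFinEquiv ⟨i, x⟩)
    have key : ∀ s : (Σ i, Fin (k' i)), s = ⟨i, p i x⟩ →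
        ∃ y : {y // p s.1 y = s.2}, (⟨s.1, y.1⟩ : Σ i, Fin (k i)) = ⟨i, x⟩ := by
      rintro _ rfl
      exact ⟨⟨x, rfl⟩, rfl⟩
    obtain ⟨y, hy⟩ := key _ e
    exact ⟨y, Subtype.ext (congrArg finSigmaFinEquiv hy)⟩
  · rintro ⟨x, hx⟩
    rw [Category.assoc]
    exact eqToHom_congr (X := fun s : (Σ i, Fin (k i)) => X s.1 s.2)
      (fun s => g s.1 s.2 ≫ f s.1) 
      (Equiv.symm_apply_apply finSigmaFinEquiv ⟨(finSigmaFinEquiv.symm j).1, x⟩).symm _ _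

theorem cone_act_comp {n m : ℕ} (p : Fin n → Fin m) {Y : Fin m → C} {Z : C} {k : Fin m → ℕ}
    {X : ∀ j, Fin (k j) → C} (f : ∀ i, Y (p i) ⟶ Z) (g : ∀ j l, X j l ⟶ Y j) :
    (cone C).comp (X := X) (coneAct p (fun _ => rfl) f) g =
      coneAct (blockMap p k) (concat_blockMap p X)
        ((cone C).comp (X := fun i => X (p i)) f (fun i => g (p i))) := by
  funext j
  change _ ≫ (∑ x : {x // p x = (finSigmaFinEquiv.symm j).1}, _) =
    ∑ J : {J // blockMap p k J = j}, eqToHom _ ≫ (g (p (finSigmaFinEquiv.symm J.1).1)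
      (finSigmaFinEquiv.symm J.1).2 ≫ f (finSigmaFinEquiv.symm J.1).1)
  rw [comp_sum]
  refine Fintype.sum_bijective (fun x => ⟨finSigmaFinEquiv ⟨x.1,
    Fin.cast (congrArg k x.2).symm (finSigmaFinEquiv.symm j).2⟩, ?h⟩) ⟨?_, ?_⟩ _ _ ?_
  case h =>
    rw [blockMap, ← Equiv.eq_symm_apply]
    refine (congrArg (fun t : Σ i, Fin (k (p i)) => (⟨p t.1, t.2⟩ : Σ i, Fin (k i)))
      (Equiv.symm_apply_apply finSigmaFinEquiv ⟨x.1, _⟩)).trans ?_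
    exact Sigma.ext x.2 ((Fin.heq_ext_iff (congrArg k x.2)).2 rfl)
  · rintro ⟨a, ha⟩ ⟨b, hb⟩ h
    have := finSigmaFinEquiv.injective (congrArg Subtype.val h)
    exact Subtype.ext (Sigma.mk.inj this).1
  · rintro ⟨J, hJ⟩
    obtain ⟨⟨i, x⟩, rfl⟩ := finSigmaFinEquiv.surjective J
    have e : finSigmaFinEquiv.symm j = ⟨p i, x⟩ := by
      rw [← hJ, blockMap, Equiv.symm_apply_apply]
      exact congrArg (fun t : Σ i, Fin (k (p i)) => (⟨p t.1, t.2⟩ : Σ i, Fin (k i)))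
        (Equiv.symm_apply_apply finSigmaFinEquiv ⟨i, x⟩)
    have key : ∀ s : (Σ i, Fin (k i)), s = ⟨p i, x⟩ →
        ∃ y : {y // p y = s.1},
          (⟨y.1, Fin.cast (congrArg k y.2).symm s.2⟩ : Σ i, Fin (k (p i))) = ⟨i, x⟩ := by
      rintro _ rfl
      exact ⟨⟨i, rfl⟩, rfl⟩
    obtain ⟨y, hy⟩ := key _ e
    exact ⟨y, Subtype.ext (congrArg finSigmaFinEquiv hy)⟩
  · rintro ⟨x, hx⟩
    have key : ∀ (s : Σ i, Fin (k i)) (hx : p x = s.1) (h1 : Y s.1 = Y (p x))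
        (h2 : X s.1 s.2 = X (p x) (Fin.cast (congrArg k hx).symm s.2)),
        g s.1 s.2 ≫ eqToHom h1 ≫ f x =
          eqToHom h2 ≫ g (p x) (Fin.cast (congrArg k hx).symm s.2) ≫ f x := by
      rintro ⟨a, b⟩ hx h1 h2
      obtain rfl : p x = a := hx
      simp
    have h2 : X (finSigmaFinEquiv.symm j).1 (finSigmaFinEquiv.symm j).2 =
        X (p x) (Fin.cast (congrArg k hx).symm (finSigmaFinEquiv.symm j).2) := by
      have : ∀ (s : Σ i, Fin (k i)) (hx : p x = s.1), X s.1 s.2 =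
          X (p x) (Fin.cast (congrArg k hx).symm s.2) := by
        rintro ⟨a, b⟩ hx
        obtain rfl : p x = a := hx
        rfl
      exact this _ hx
    refine (key _ hx _ h2).trans ?_
    exact eqToHom_congr (X := fun s : (Σ i, Fin (k (p i))) => X (p s.1) s.2)
      (fun s => g (p s.1) s.2 ≫ f s.1) 
      (Equiv.symm_apply_apply finSigmaFinEquiv
        ⟨x, Fin.cast (congrArg k hx).symm (finSigmaFinEquiv.symm j).2⟩).symm _ _

end Cone

/-- The cartesian multicategory `C_▸` of a preadditive category `C`. -/
def fpCone (C : Type u) [Category.{v} C] [CMonEnriched C] : CartMulticat.{v, u} where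
  toMulticat := cone C
  act p _ _ h _ f := coneAct (C := C) p h f
  act_id f := coneAct_id (C := C) f
  act_comp p q _ _ _ hp hq _ f := coneAct_comp (C := C) p q hp hq f
  comp_act p hp f g := cone_comp_act (C := C) p hp f g
  act_comp_eq p _ _ _ _ f g := cone_act_comp (C := C) p f g

theorem IsAdditive.map_sum {C D : Type u} [Category.{v} C] [Category.{v} D] [CMonEnriched C]
    [CMonEnriched D] {F : C ⥤ D} (hF : IsAdditive F) {X Y : C} {ι : Type}
    (s : Finset ι) (f : ι → (X ⟶ Y)) : F.map (∑ i ∈ s, f i) = ∑ i ∈ s, F.map (f i) := by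
  classical
  induction s using Finset.induction_on with
  | empty => simpa using hF.map_zero X Y
  | insert a s ha ih => rw [Finset.sum_insert ha, Finset.sum_insert ha, hF.map_add, ih]

theorem IsAdditive.map_coneAct {C D : Type u} [Category.{v} C] [Category.{v} D] [CMonEnriched C]
    [CMonEnriched D] {F : C ⥤ D} (hF : IsAdditive F) {n m : ℕ} (p : Fin n → Fin m)
    {X : Fin n → C} {X' : Fin m → C} (h : ∀ i, X i = X' (p i)) {Y : C} (f : ∀ i, X i ⟶ Y)
    (j : Fin m) : F.map (coneAct p h f j) =
      coneAct (X := fun i => F.obj (X i)) (X' := fun i => F.obj (X' i)) p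
        (fun i => congrArg F.obj (h i)) (fun i => F.map (f i)) j := by
  unfold coneAct
  rw [hF.map_sum]
  simp [eqToHom_map]

/-- The functor `(-)_▸` from preadditive categories to cartesian multicategories; an additive
functor is applied to each component of a sequence of concurrent arrows. -/
def fpConeFunctor : CMonCat.{v, u} ⥤ CartMulticat.{v, u} where
  obj C := fpCone C.carrier
  map {C _} F :=
    { obj := fun X : C.carrier => F.1.obj X
      map := fun {n} {X : Fin n → C.carrier} {Y : C.carrier} (f : ∀ i, X i ⟶ Y) =>
        fun i => F.1.map (f i)
      map_id := fun X => funext fun _ => F.1.map_id X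
      map_comp := fun _ _ => funext fun _ => F.1.map_comp _ _
      map_act := fun p _ _ h _ f => funext fun j => F.2.map_coneAct p h f j }
  map_id _ := rfl
  map_comp _ _ := rfl

/-! ### Finite product categories -/

section Times

variable {C : Type u} [Category.{v} C] [HasFiniteProducts C]

/-- The projection from a product to the `j`-th factor, when this is (propositionally) `Y`. -/
noncomputable def proj {n : ℕ} (X : Fin n → C) (j : Fin n) {Y : C} (h : Y = X j) : ∏ᶜ X ⟶ Y :=
  Pi.π X j ≫ eqToHom h.symm

/-- The morphism between products determined by a mapping of the indices, built from
projections and diagonals. -/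
noncomputable def reind {n m : ℕ} (p : Fin n → Fin m) {X : Fin n → C} {X' : Fin m → C}
    (h : ∀ i, X i = X' (p i)) : ∏ᶜ X' ⟶ ∏ᶜ X :=
  Pi.lift fun i => proj X' (p i) (h i)

/-- The projection of the product of a concatenation onto the product of the `i`-th block. -/
noncomputable def blockProj {n : ℕ} {k : Fin n → ℕ} (X : ∀ i, Fin (k i) → C) (i : Fin n) :
    ∏ᶜ (concat X) ⟶ ∏ᶜ (X i) :=
  reind (fun l => finSigmaFinEquiv ⟨i, l⟩) fun l => (concat_apply X ⟨i, l⟩).symm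

/-- Composition in `C_×`: `f ∘ (g₁ × ⋯ × gₙ)`. -/
noncomputable def timesComp {n : ℕ} {Y : Fin n → C} {Z : C} {k : Fin n → ℕ} {X : ∀ i, Fin (k i) → C}
    (f : ∏ᶜ Y ⟶ Z) (g : ∀ i, ∏ᶜ (X i) ⟶ Y i) : ∏ᶜ (concat X) ⟶ Z :=
  Pi.lift (fun i => blockProj X i ≫ g i) ≫ f

@[ext 1100]
theorem pi_ext {n : ℕ} {X : Fin n → C} {W : C} {f g : W ⟶ ∏ᶜ X}
    (h : ∀ i, f ≫ proj X i rfl = g ≫ proj X i rfl) : f = g :=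
  Pi.hom_ext _ _ fun i => by simpa [proj] using h i

theorem lift_proj {n : ℕ} {X : Fin n → C} {W Y : C} (f : ∀ i, W ⟶ X i) (j : Fin n)
    (h : Y = X j) : Pi.lift f ≫ proj X j h = f j ≫ eqToHom h.symm := by
  simp [proj]

theorem proj_eqToHom {n : ℕ} {X : Fin n → C} {Y Y' : C} (j : Fin n)
    (h : Y = X j) (h' : Y = Y') : proj X j h ≫ eqToHom h' = proj X j (h'.symm.trans h) := by
  simp [proj]

theorem reind_proj {n m : ℕ} (p : Fin n → Fin m) {X : Fin n → C} {X' : Fin m → C}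
    (h : ∀ i, X i = X' (p i)) (j : Fin n) {Y : C} (hj : Y = X j) :
    reind p h ≫ proj X j hj = proj X' (p j) (hj.trans (h j)) := by
  simp [reind, lift_proj, proj_eqToHom]

theorem reind_reind {n m r : ℕ} (p : Fin n → Fin m) (q : Fin m → Fin r) {X : Fin n → C}
    {X' : Fin m → C} {X'' : Fin r → C} (hp : ∀ i, X i = X' (p i))
    (hq : ∀ i, X' i = X'' (q i)) :
    reind q hq ≫ reind p hp = reind (fun i => q (p i)) (fun i => (hp i).trans (hq (p i))) := by
  ext i
  simp [reind_proj]

theorem reind_reind_comp {n m r : ℕ} (p : Fin n → Fin m) (q : Fin m → Fin r) {X : Fin n → C}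
    {X' : Fin m → C} {X'' : Fin r → C} (hp : ∀ i, X i = X' (p i))
    (hq : ∀ i, X' i = X'' (q i)) {Y : C} (f : ∏ᶜ X ⟶ Y) :
    reind q hq ≫ reind p hp ≫ f =
      reind (fun i => q (p i)) (fun i => (hp i).trans (hq (p i))) ≫ f := by
  rw [← Category.assoc, reind_reind]

theorem reind_id {n : ℕ} (X : Fin n → C) :
    reind (fun i => i) (fun _ => rfl : ∀ i, X i = X i) = 𝟙 _ := by
  ext i
  simp [reind_proj]

theorem reind_congr {n m : ℕ} {p q : Fin n → Fin m} (e : ∀ i, p i = q i) {X : Fin n → C}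
    {X' : Fin m → C} (hp : ∀ i, X i = X' (p i)) (hq : ∀ i, X i = X' (q i)) :
    reind p hp = reind q hq := by
  obtain rfl : p = q := funext e
  rfl

theorem lift_comp_reind {n m : ℕ} (p : Fin n → Fin m) {X : Fin m → C} {W : C}
    (f : ∀ i, W ⟶ X i) :
    Pi.lift f ≫ reind p (fun i => (rfl : X (p i) = X (p i))) = Pi.lift fun i => f (p i) := by
  ext i
  simp [reind_proj, lift_proj]

theorem comp_lift {n : ℕ} {X : Fin n → C} {W W' : C} (f : ∀ i, W ⟶ X i) (g : W' ⟶ W) :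
    g ≫ Pi.lift f = Pi.lift fun i => g ≫ f i := by
  ext i
  simp [lift_proj]

theorem heq_times {n m : ℕ} {X : Fin n → C} {X' : Fin m → C} {Y : C} (h : n = m)
    (hX : ∀ i, X' i = X (Fin.cast h.symm i)) (f : ∏ᶜ X ⟶ Y) (g : ∏ᶜ X' ⟶ Y)
    (H : f = reind (Fin.cast h.symm) hX ≫ g) : HEq f g := by
  subst h
  obtain rfl : X' = X := funext hX
  refine heq_of_eq (H.trans ?_)
  exact (congrArg (· ≫ g) (reind_id X')).trans (Category.id_comp g)

theorem times_id_comp {n : ℕ} {X : Fin n → C} {Y : C} (f : ∏ᶜ X ⟶ Y) :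
    HEq (timesComp (X := fun _ : Fin 1 => X) (proj (fun _ : Fin 1 => Y) 0 rfl)
      (fun _ : Fin 1 => f)) f := by
  refine heq_times (by simp) (fun i => ?_) _ _ ?_
  · refine (concat_apply (fun _ : Fin 1 => X) ⟨0, i⟩).symm.trans (congrArg _ (Fin.ext ?_))
    simp
  · rw [timesComp, lift_proj]
    simp only [eqToHom_refl, Category.comp_id, blockProj]
    congr 1
    exact reind_congr (fun i => Fin.ext (by simp)) _ _

theorem times_comp_id {n : ℕ} {X : Fin n → C} {Y : C} (f : ∏ᶜ X ⟶ Y) :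
    HEq (timesComp (X := fun i (_ : Fin 1) => X i) f
      (fun i => proj (fun _ : Fin 1 => X i) 0 rfl)) f := by
  have e : ∀ i : Fin n, finSigmaFinEquiv (⟨i, 0⟩ : Σ _ : Fin n, Fin 1) =
      Fin.cast (by simp) i := fun i => Fin.ext (by rw [finSigmaFinEquiv_apply]; simp)
  refine heq_times (by simp) (fun i => ?_) _ _ ?_
  · exact (concat_apply (fun i (_ : Fin 1) => X i) ⟨i, 0⟩).symm.trans (congrArg _ (e i))
  · rw [timesComp]
    congr 1
    ext i
    simp only [lift_proj, eqToHom_refl, Category.comp_id, blockProj, reind_proj]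
    have : ∀ {a b : Fin (∑ _ : Fin n, 1)} (h : a = b) (ha hb),
        proj (concat fun i (_ : Fin 1) => X i) a (Y := X i) ha = proj _ b hb := by
      rintro a _ rfl _ _; rfl
    exact this (e i) _ _

theorem times_assoc {n : ℕ} {W : Fin n → C} {Z : C} {k : Fin n → ℕ} {Y : ∀ i, Fin (k i) → C}
    {m : ∀ i, Fin (k i) → ℕ} {X : ∀ i l, Fin (m i l) → C}
    (f : ∏ᶜ W ⟶ Z) (g : ∀ i, ∏ᶜ (Y i) ⟶ W i) (h : ∀ i l, ∏ᶜ (X i l) ⟶ Y i l) :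
    HEq (timesComp (k := concat m)
        (X := fun j => X (finSigmaFinEquiv.symm j).1 (finSigmaFinEquiv.symm j).2)
        (timesComp f g)
        (fun j => h (finSigmaFinEquiv.symm j).1 (finSigmaFinEquiv.symm j).2))
      (timesComp f (fun i => timesComp (g i) (h i))) := by
  have hX : ∀ J : Fin (∑ i, ∑ l, m i l), concat (fun i => concat (X i)) J =
      concat (fun j => X (finSigmaFinEquiv.symm j).1 (finSigmaFinEquiv.symm j).2)
        (Fin.cast (block_count m).symm J) := fun J => (congrArg
      (fun s : (Σ a : (Σ i, Fin (k i)), Fin (m a.1 a.2)) => X s.1.1 s.1.2 s.2)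
      (block_assoc_symm m (Fin.cast (block_count m).symm J) J rfl)).symm
  refine heq_times (block_count m) hX _ _ ?_
  have key : ∀ (i : Fin n) (l : Fin (k i)) (N : ℕ) (V : Fin N → C) (s : Σ i, Fin (k i))
      (hs : s = ⟨i, l⟩) (p : Fin (m s.1 s.2) → Fin N) (hp : ∀ t, X s.1 s.2 t = V (p t))
      (q : Fin (m i l) → Fin N) (hq : ∀ t, X i l t = V (q t))
      (_ : ∀ t, p t = q (Fin.cast (congrArg (fun s : Σ i, Fin (k i) => m s.1 s.2) hs) t))
      (hY : Y s.1 s.2 = Y i l),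
      (reind p hp ≫ h s.1 s.2) ≫ eqToHom hY = reind q hq ≫ h i l := by
    rintro i l N V _ rfl p hp q hq hpq hY
    simp only [eqToHom_refl, Category.comp_id]
    exact congrArg (· ≫ h i l) (reind_congr hpq hp hq)
  have inner : ∀ i, Pi.lift (fun j => blockProj (k := concat m)
        (fun j => X (finSigmaFinEquiv.symm j).1 (finSigmaFinEquiv.symm j).2) j ≫
          h (finSigmaFinEquiv.symm j).1 (finSigmaFinEquiv.symm j).2) ≫ blockProj Y i =
      reind (Fin.cast (block_count m).symm) hX ≫ blockProj (fun i => concat (X i)) i ≫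
        Pi.lift fun l => blockProj (X i) l ≫ h i l := by
    intro i
    refine pi_ext fun l => ?_
    rw [Category.assoc, blockProj, reind_proj, lift_proj]
    simp only [Category.assoc, lift_proj, eqToHom_refl, Category.comp_id]
    rw [blockProj, blockProj, blockProj, reind_reind_comp, reind_reind_comp]
    refine (Category.assoc _ _ _).symm.trans ?_
    refine key i l _ _ (finSigmaFinEquiv.symm (finSigmaFinEquiv ⟨i, l⟩))
      (Equiv.symm_apply_apply _ _) _ _ _ _ (fun t => ?_) _
    apply Fin.ext
    exact block_assoc m ⟨⟨i, l⟩, Fin.cast (concat_apply m ⟨i, l⟩) t⟩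
  rw [timesComp, timesComp, timesComp, ← Category.assoc, ← Category.assoc, comp_lift, comp_lift]
  congr 2
  funext i
  rw [← Category.assoc, inner i, timesComp]
  simp only [Category.assoc]

theorem times_comp_act {n : ℕ} {Y : Fin n → C} {Z : C} {k k' : Fin n → ℕ}
    {X : ∀ i, Fin (k i) → C} {X' : ∀ i, Fin (k' i) → C}
    (p : ∀ i, Fin (k i) → Fin (k' i)) (hp : ∀ i l, X i l = X' i (p i l))
    (f : ∏ᶜ Y ⟶ Z) (g : ∀ i, ∏ᶜ (X i) ⟶ Y i) :
    timesComp (X := X') f (fun i => reind (p i) (hp i) ≫ g i) =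
      reind (sumMap p) (concat_sumMap p hp) ≫ timesComp f g := by
  rw [timesComp, timesComp, ← Category.assoc, comp_lift]
  congr 2
  funext i
  rw [← Category.assoc, ← Category.assoc, blockProj, blockProj, reind_reind, reind_reind]
  congr 1
  refine reind_congr (fun l => ?_) _ _
  exact (congrArg (fun t : Σ i, Fin (k i) => finSigmaFinEquiv
    (⟨t.1, p t.1 t.2⟩ : Σ i, Fin (k' i)))
    (Equiv.symm_apply_apply finSigmaFinEquiv ⟨i, l⟩)).symm

theorem times_act_comp {n m : ℕ} (p : Fin n → Fin m) {Y : Fin m → C} {Z : C} {k : Fin m → ℕ}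
    {X : ∀ j, Fin (k j) → C} (f : ∏ᶜ (fun i => Y (p i)) ⟶ Z) (g : ∀ j, ∏ᶜ (X j) ⟶ Y j) :
    timesComp (reind p (fun _ => rfl) ≫ f) g =
      reind (blockMap p k) (concat_blockMap p X) ≫ timesComp f (fun i => g (p i)) := by
  rw [timesComp, timesComp, ← Category.assoc, ← Category.assoc, comp_lift, lift_comp_reind]
  congr 2
  funext i
  rw [← Category.assoc, blockProj, blockProj, reind_reind]
  congr 1
  refine reind_congr (fun l => ?_) _ _
  exact (congrArg (fun t : Σ i, Fin (k (p i)) => finSigmaFinEquiv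
    (⟨p t.1, t.2⟩ : Σ i, Fin (k i)))
    (Equiv.symm_apply_apply finSigmaFinEquiv ⟨i, l⟩)).symm

end Times

/-- The cartesian multicategory `C_×` of a finite product category `C`: an arrow
`X₁, …, Xₙ → Y` is an arrow `X₁ × ⋯ × Xₙ ⟶ Y` in `C`, and mappings act by composition with
diagonals and projections. -/
noncomputable def fpTimes (C : Type u) [Category.{v} C] [HasFiniteProducts C] : CartMulticat.{v, u} where
  Ob := C
  Hom X Y := ∏ᶜ X ⟶ Y
  id X := proj (fun _ : Fin 1 => X) 0 rfl
  comp f g := timesComp f g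
  id_comp f := times_id_comp f
  comp_id f := times_comp_id f
  assoc f g h := times_assoc f g h
  act p _ _ h _ f := reind p h ≫ f
  act_id f := (congrArg (· ≫ f) (reind_id _)).trans (Category.id_comp f)
  act_comp p q _ _ _ hp hq _ f :=
    (congrArg (· ≫ f) (reind_reind p q hp hq).symm).trans (Category.assoc _ _ _)
  comp_act p hp f g := times_comp_act p hp f g
  act_comp_eq p _ _ _ _ f g := times_act_comp p f g

/-- Bundled finite product categories. -/
structure ProdCat where
  carrier : Type u
  [category : Category.{v} carrier]
  [hasFiniteProducts : HasFiniteProducts carrier]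

attribute [instance] ProdCat.category ProdCat.hasFiniteProducts

/-- The category of finite product categories and finite product preserving functors. -/
instance : Category ProdCat.{v, u} where
  Hom C D := {F : C.carrier ⥤ D.carrier // PreservesFiniteProducts F}
  id C := ⟨𝟭 _, inferInstance⟩
  comp F G := ⟨F.1 ⋙ G.1, by
    have := F.2
    have := G.2
    exact comp_preservesFiniteProducts _ _⟩

section TimesMap

variable {C D : Type u} [Category.{v} C] [Category.{v} D] [HasFiniteProducts C]
  [HasFiniteProducts D] (F : C ⥤ D) [PreservesFiniteProducts F]

/-- The canonical isomorphism `F X₁ × ⋯ × F Xₙ ⟶ F (X₁ × ⋯ × Xₙ)`. -/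
noncomputable def comparison {n : ℕ} (X : Fin n → C) :
    ∏ᶜ (fun i => F.obj (X i)) ⟶ F.obj (∏ᶜ X) :=
  (PreservesProduct.iso F X).inv

theorem comparison_proj {n : ℕ} (X : Fin n → C) (j : Fin n) {Y : C} (h : Y = X j) :
    comparison F X ≫ F.map (proj X j h) = proj (fun i => F.obj (X i)) j (congrArg F.obj h) := by
  subst h
  simp [comparison, proj, Iso.inv_comp_eq]

theorem comparison_lift {n m : ℕ} (X : Fin n → C) (Y : Fin m → C) (g : ∀ i, ∏ᶜ X ⟶ Y i) :
    comparison F X ≫ F.map (Pi.lift g) =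
      Pi.lift (fun i => comparison F X ≫ F.map (g i)) ≫ comparison F Y := by
  rw [← cancel_mono (PreservesProduct.iso F Y).hom]
  have e : comparison F Y ≫ (PreservesProduct.iso F Y).hom = 𝟙 _ := Iso.inv_hom_id _
  rw [Category.assoc, Category.assoc, e, Category.comp_id]
  refine Pi.hom_ext _ _ fun i => ?_
  simp

theorem comparison_reind {n m : ℕ} (p : Fin n → Fin m) {X : Fin n → C} {X' : Fin m → C}
    (h : ∀ i, X i = X' (p i)) :
    comparison F X' ≫ F.map (reind p h) =
      reind (X := fun i => F.obj (X i)) (X' := fun i => F.obj (X' i)) p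
        (fun i => congrArg F.obj (h i)) ≫ comparison F X := by
  rw [reind, comparison_lift]
  simp only [comparison_proj]
  rfl

theorem comparison_timesComp {n : ℕ} {Y : Fin n → C} {Z : C} {k : Fin n → ℕ}
    {X : ∀ i, Fin (k i) → C} (f : ∏ᶜ Y ⟶ Z) (g : ∀ i, ∏ᶜ (X i) ⟶ Y i) :
    comparison F (concat X) ≫ F.map (timesComp f g) =
      timesComp (Y := fun i => F.obj (Y i)) (X := fun i l => F.obj (X i l))
        (comparison F Y ≫ F.map f) (fun i => comparison F (X i) ≫ F.map (g i)) := by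
  rw [timesComp, F.map_comp, ← Category.assoc, comparison_lift, timesComp, Category.assoc]
  congr 2
  funext i
  rw [F.map_comp, ← Category.assoc, ← Category.assoc, blockProj, comparison_reind]
  rfl

end TimesMap

theorem comparison_id {n : ℕ} {C : Type u} [Category.{v} C] [HasFiniteProducts C]
    (X : Fin n → C) : comparison (𝟭 C) X = 𝟙 (∏ᶜ X) := by
  refine pi_ext (X := X) fun i => ?_
  exact (comparison_proj (𝟭 C) X i rfl).trans (Category.id_comp _).symm

theorem comparison_comp {n : ℕ} {C D E : Type u} [Category.{v} C] [Category.{v} D]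
    [Category.{v} E] [HasFiniteProducts C] [HasFiniteProducts D] [HasFiniteProducts E]
    (F : C ⥤ D) (G : D ⥤ E) [PreservesFiniteProducts F] [PreservesFiniteProducts G]
    [PreservesFiniteProducts (F ⋙ G)] (X : Fin n → C) :
    comparison (F ⋙ G) X = comparison G (fun i => F.obj (X i)) ≫ G.map (comparison F X) := by
  rw [← cancel_mono (PreservesProduct.iso (F ⋙ G) X).hom]
  have e : comparison (F ⋙ G) X ≫ (PreservesProduct.iso (F ⋙ G) X).hom = 𝟙 _ :=
    Iso.inv_hom_id _
  rw [e]
  refine pi_ext fun i => ?_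
  have h1 : (PreservesProduct.iso (F ⋙ G) X).hom ≫
      proj (fun i => (F ⋙ G).obj (X i)) i rfl = G.map (F.map (proj X i rfl)) := by
    rw [PreservesProduct.iso_hom, proj, proj, eqToHom_refl, eqToHom_refl, Category.comp_id,
      Category.comp_id]
    exact piComparison_comp_π (F ⋙ G) X i
  rw [Category.assoc, Category.id_comp, h1, Category.assoc, ← G.map_comp, comparison_proj]
  exact (comparison_proj G (fun i => F.obj (X i)) i rfl).symm

/-- The functor `(-)_×` from finite product categories to cartesian multicategories; `F_×` sends
`f : X₁ × ⋯ × Xₙ ⟶ Y` to the composite `F X₁ × ⋯ × F Xₙ ≅ F (X₁ × ⋯ × Xₙ) ⟶ F Y`. -/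
noncomputable def fpTimesFunctor : ProdCat.{v, u} ⥤ CartMulticat.{v, u} where
  obj C := fpTimes C.carrier
  map {C _} F :=
    haveI := F.2
    { obj := fun X : C.carrier => F.1.obj X
      map := fun {n} {X : Fin n → C.carrier} {Y : C.carrier} (f : ∏ᶜ X ⟶ Y) =>
        comparison F.1 X ≫ F.1.map f
      map_id := fun X : C.carrier => comparison_proj F.1 (fun _ : Fin 1 => X) 0 rfl
      map_comp := fun f g => comparison_timesComp F.1 f g
      map_act := fun p _ _ h _ f => by
        refine (congrArg (comparison F.1 _ ≫ ·) (F.1.map_comp (reind (C := C.carrier) p h) f)).trans ?_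
        refine (Category.assoc _ _ _).symm.trans ?_
        refine (congrArg (· ≫ F.1.map f) (comparison_reind (C := C.carrier) F.1 p h)).trans ?_
        exact Category.assoc _ _ _ }
  map_id C := by
    refine FpFunctor.ext rfl (heq_of_eq ?_)
    funext n X Y f
    exact (congrArg (· ≫ f) (comparison_id (C := C.carrier) X)).trans (Category.id_comp _)
  map_comp {C D E} F G := by
    have := F.2
    have := G.2
    have : PreservesFiniteProducts (F.1 ⋙ G.1) := (F ≫ G).2
    refine FpFunctor.ext rfl (heq_of_eq ?_)
    funext n X Y f
    refine (congrArg (· ≫ G.1.map (F.1.map f))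
      (comparison_comp (C := C.carrier) F.1 G.1 X)).trans ?_
    refine (Category.assoc _ _ _).trans ?_
    exact congrArg (comparison G.1 _ ≫ ·) (G.1.map_comp _ _).symm

/-! ### Cartesian multicategories over categories with finite sums -/

/-- The multicategories isomorphic to `C_▸` for some category `C`. -/
def discreteCones : ObjectProperty Multicat.{v, u} := fun M =>
  ∃ (C : Type u) (_ : Category.{v} C), Nonempty (M ≅ cone C)

/-- The representable multicategories. -/
def representables : ObjectProperty Multicat.{v, u} := fun M => M.IsRepresentable

/-- The representable multicategories isomorphic to `C_▸` for some category `C`. -/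
def sumMulticats : ObjectProperty Multicat.{v, u} := discreteCones ⊓ representables

/-- The cartesian multicategories whose underlying multicategory is in `sumMulticats`. -/
def fpSum : ObjectProperty CartMulticat.{v, u} := sumMulticats.inverseImage underlying

/-- Preadditive categories with finite sums. -/
def hasSums : ObjectProperty CMonCat.{v, u} := fun C => HasFiniteCoproducts C.carrier

/-- The category `C` has finite sums and finite products, and there is some isomorphism
`X + Y ≅ X × Y` natural in `X` and `Y`. -/
def HasNaturallyIsoSumsProducts (C : Type u) [Category.{v} C] : Prop :=
  ∃ (_ : HasFiniteCoproducts C) (_ : HasFiniteProducts C),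
    Nonempty ((coprod.functor : C ⥤ C ⥤ C) ≅ prod.functor)

/-- Finite product categories with finite sums naturally isomorphic to the products. -/
def sumsIsoProducts : ObjectProperty ProdCat.{v, u} := fun C =>
  HasNaturallyIsoSumsProducts C.carrier

/-- A functor between preadditive categories preserves finite biproducts: it preserves zero
morphisms and sends biproduct diagrams to biproduct diagrams. -/
def PreservesBiproducts {C D : Type u} [Category.{v} C] [Category.{v} D] [CMonEnriched C]
    [CMonEnriched D] (F : C ⥤ D) : Prop :=
  ∃ _ : F.PreservesZeroMorphisms, PreservesFiniteBiproducts F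

end CartMulti

namespace CartMulti

/-! ### Biproducts in categories enriched in commutative monoids -/

section Biproducts

variable {C : Type u} [Category.{v} C] [CMonEnriched C]

/-! The heart of the matter is that, when `C` has finite sums, an fp-structure on `C_▸` is the same
thing as an enrichment of `C` in commutative monoids. The mappings `0 → 1` and `2 → 1` produce zero
arrows and a binary operation on each hom-set. The compatibility of the action with composition
makes the operation bilinear, and functoriality in the mapping makes zero a unit. Coproducts give
the interchange law, so Eckmann–Hilton yields a commutative monoid (`FpStructure.cMonEnriched`).
With this enrichment the coproducts are biproducts. Every sequence of arrows `X i ⟶ Y` is the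
universal cocone followed by one arrow, and the action on the universal cocone is detected by the
biproduct projections, where its entries are identities and zeros. The given action is therefore the
one by sums (`FpStructure.toCartMulticat_eq`).

For (1), pre-universal arrows of `C_▸` are exactly coproduct cocones, so representability of `C_▸`
means finite sums. Together with transport of fp-structures along isomorphisms this gives essential
surjectivity (`exists_iso_fpCone`). A functor `C_▸ ⟶ D_▸` acts componentwise through its unary part
(`Multifunctor.map_apply`), and commuting with the mappings `n → 1` makes that part additive; this
gives fullness and faithfulness.

For (2), a natural isomorphism `X + Y ≅ X × Y` forces a zero object and, having a diagonal matrix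
with invertible entries, forces the canonical arrow `X + Y ⟶ X × Y` to be invertible. So there are
biproducts and an enrichment. The decomposition of the identity of a product then gives `C_▸ ≅ C_×`
(`fpConeIsoFpTimes`), natural in additive functors, and (2) reduces to (1).

For (3), everything rests on the equation `∑ πⱼ ≫ ιⱼ = 𝟙`. For a finite bicone it follows from
either universal property, implies both, and is preserved by additive functors; conversely a functor
that preserves it on `X ⊕ X` preserves sums of arrows. -/

theorem sum_comp_ι_π {J : Type} [Fintype J] {X : J → C} (b : Bicone X) {W : C}
    (f : ∀ j, W ⟶ X j) (j : J) : (∑ i, f i ≫ b.ι i) ≫ b.π j = f j := by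
  classical
  rw [sum_comp, Finset.sum_eq_single_of_mem j (Finset.mem_univ j)]
  · simp
  · intro i _ hi
    rw [Category.assoc, bicone_ι_π_ne b hi, comp_zero]

theorem ι_comp_sum_π {J : Type} [Fintype J] {X : J → C} (b : Bicone X) {W : C}
    (f : ∀ j, X j ⟶ W) (j : J) : b.ι j ≫ (∑ i, b.π i ≫ f i) = f j := by
  classical
  rw [comp_sum, Finset.sum_eq_single_of_mem j (Finset.mem_univ j)]
  · simp
  · intro i _ hi
    rw [← Category.assoc, bicone_ι_π_ne b hi.symm, zero_comp]

/-- In a category enriched in commutative monoids, a finite bicone with `∑ πⱼ ≫ ιⱼ = 𝟙`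
is a biproduct. -/
noncomputable def isBilimitOfTotal {J : Type} [Fintype J] {X : J → C} (b : Bicone X)
    (total : ∑ j, b.π j ≫ b.ι j = 𝟙 b.pt) : b.IsBilimit where
  isLimit :=
    { lift := fun s => ∑ j, s.π.app ⟨j⟩ ≫ b.ι j
      fac := fun s j => sum_comp_ι_π b (fun j => s.π.app ⟨j⟩) j.as
      uniq := fun s m h => by
        refine (Category.comp_id m).symm.trans ?_
        refine (congrArg (m ≫ ·) total.symm).trans ((comp_sum _ _ _).trans ?_)
        exact Finset.sum_congr rfl fun j _ =>
          (Category.assoc _ _ _).symm.trans (congrArg (· ≫ b.ι j) (h ⟨j⟩)) }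
  isColimit :=
    { desc := fun s => ∑ j, b.π j ≫ s.ι.app ⟨j⟩
      fac := fun s j => ι_comp_sum_π b (fun j => s.ι.app ⟨j⟩) j.as
      uniq := fun s m h => by
        refine (Category.id_comp m).symm.trans ?_
        refine (congrArg (· ≫ m) total.symm).trans ((sum_comp _ _ _).trans ?_)
        exact Finset.sum_congr rfl fun j _ =>
          (Category.assoc _ _ _).trans (congrArg (b.π j ≫ ·) (h ⟨j⟩)) }

/-- Both sides have the same composites with all projections. With the dual statement and
`isBilimitOfTotal`, each half of the universal property implies the other. -/
theorem total_of_isLimit {J : Type} [Fintype J] {X : J → C} (b : Bicone X)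
    (h : IsLimit b.toCone) : ∑ j, b.π j ≫ b.ι j = 𝟙 b.pt :=
  h.hom_ext fun j => (sum_comp_ι_π b _ j.as).trans (Category.id_comp _).symm

theorem total_of_isColimit {J : Type} [Fintype J] {X : J → C} (b : Bicone X)
    (h : IsColimit b.toCocone) : ∑ j, b.π j ≫ b.ι j = 𝟙 b.pt :=
  h.hom_ext fun j => (ι_comp_sum_π b _ j.as).trans (Category.comp_id _).symm

/-- The coproduct becomes a bicone once its projections are defined by the Kronecker delta; its
universal property then gives the total identity. -/
theorem hasFiniteBiproducts_of_hasFiniteCoproducts [HasFiniteCoproducts C] :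
    HasFiniteBiproducts C := by
  classical
  refine ⟨fun n => ⟨fun X => ?_⟩⟩
  let b : Bicone X :=
    { pt := ∐ X
      ι := Sigma.ι X
      π := fun j => Sigma.desc fun i => if h : i = j then eqToHom (congrArg X h) else 0
      ι_π := fun i j => by simp; congr }
  refine HasBiproduct.mk ⟨b, isBilimitOfTotal b (total_of_isColimit b ?_)⟩
  exact (coproductIsCoproduct X).ofIsoColimit (Cocone.ext (Iso.refl _) fun _ => by
    simp [b])

theorem hasNaturallyIsoSumsProducts_of_hasFiniteBiproducts [HasFiniteBiproducts C] :
    HasNaturallyIsoSumsProducts C := by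
  have : HasBinaryBiproducts C := hasBinaryBiproducts_of_finite_biproducts C
  let e : ∀ X Y : C, X ⨿ Y ≅ X ⨯ Y := fun X Y => (biprod.isoCoprod X Y).symm ≪≫ biprod.isoProd X Y
  -- Arrows from a sum to a product are compared entry by entry as 2 × 2 matrices.
  have nat : ∀ {X X' Y Y' : C} (f : X ⟶ X') (g : Y ⟶ Y'),
      coprod.map f g ≫ (e X' Y').hom = (e X Y).hom ≫ prod.map f g := by
    intro X X' Y Y' f g
    apply coprod.hom_ext <;> apply prod.hom_ext <;>
      simp [e, prod.lift_fst, prod.lift_snd, coprod.inl_desc, coprod.inr_desc]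
  exact ⟨inferInstance, inferInstance, ⟨NatIso.ofComponents (fun X => NatIso.ofComponents
    (e X) (nat (𝟙 X))) fun f => by ext Y; exact nat f (𝟙 Y)⟩⟩

end Biproducts

/-! ### Naturally isomorphic sums and products -/

section NaturalIso

variable {C : Type u} [Category.{v} C] [HasFiniteCoproducts C] [HasFiniteProducts C]

/-- The chain `1 ≅ 1 + 0 ≅ 1 × 0 ≅ 0` makes the initial object terminal. -/
theorem isZero_initial_of_natIso (ψ : (coprod.functor : C ⥤ C ⥤ C) ≅ prod.functor) :
    IsZero (⊥_ C) := by
  let e : (⊤_ C) ≅ (⊥_ C) :=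
    (coprod.rightUnitor (⊤_ C)).symm ≪≫ (ψ.app (⊤_ C)).app (⊥_ C) ≪≫ prod.leftUnitor (⊥_ C)
  have h : IsTerminal (⊥_ C) := terminalIsTerminal.ofIso e
  exact ⟨fun Y => ⟨⟨⟨initial.to Y⟩, fun _ => Subsingleton.elim _ _⟩⟩,
    fun Y => ⟨⟨⟨h.from Y⟩, fun _ => h.hom_ext _ _⟩⟩⟩

/-- Naturality against zero arrows makes the matrix of `ψ` diagonal, and comparison with the case of
a zero summand makes its diagonal entries invertible. The canonical arrow is `ψ` up to these
entries. -/
theorem isIso_canonical_of_natIso [HasZeroMorphisms C] (h0 : IsZero (⊥_ C))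
    (ψ : (coprod.functor : C ⥤ C ⥤ C) ≅ prod.functor) (X Y : C) :
    IsIso (coprod.desc (prod.lift (𝟙 X) 0) (prod.lift 0 (𝟙 Y)) : X ⨿ Y ⟶ X ⨯ Y) := by
  let m : ∀ X Y : C, X ⨿ Y ⟶ X ⨯ Y := fun X Y => (ψ.hom.app X).app Y
  have iso : ∀ X Y, IsIso (m X Y) := fun X Y => ((ψ.app X).app Y).isIso_hom
  have nat : ∀ {X X' Y Y' : C} (f : X ⟶ X') (g : Y ⟶ Y'),
      coprod.map f g ≫ m X' Y' = m X Y ≫ prod.map f g := by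
    intro X X' Y Y' f g
    have h1 : coprod.map (𝟙 X) g ≫ m X Y' = m X Y ≫ prod.map (𝟙 X) g :=
      (ψ.hom.app X).naturality g
    have h2 : coprod.map f (𝟙 Y') ≫ m X' Y' = m X Y' ≫ prod.map f (𝟙 Y') :=
      congrArg (fun α => α.app Y') (ψ.hom.naturality f)
    have e1 : coprod.map f g = coprod.map (𝟙 X) g ≫ coprod.map f (𝟙 Y') := by simp
    have e2 : prod.map f g = prod.map (𝟙 X) g ≫ prod.map f (𝟙 Y') := by simp
    rw [e1, e2, Category.assoc, h2, ← Category.assoc, h1, Category.assoc]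
  have hsub : ∀ {W : C} (f g : W ⟶ ⊥_ C), f = g := fun f g => h0.eq_of_tgt f g
  -- the diagonal entries
  have a1 : IsIso (coprod.inl ≫ m X Y ≫ prod.fst) := by
    -- The entry does not depend on `Y`; for `Y = 0` it is a composite of three isomorphisms.
    have e : coprod.inl ≫ m X Y ≫ prod.fst = coprod.inl ≫ m X (⊥_ C) ≫ prod.fst := by
      have := nat (𝟙 X) (0 : Y ⟶ ⊥_ C)
      have := congrArg (fun t => coprod.inl ≫ t ≫ prod.fst) this
      simpa using this.symm
    rw [e]
    have i1 : IsIso (coprod.inl : X ⟶ X ⨿ ⊥_ C) :=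
      ⟨coprod.desc (𝟙 X) 0, coprod.inl_desc _ _, by
        apply coprod.hom_ext
        · simp [coprod.inl_desc]
        · exact h0.eq_of_src _ _⟩
    have i2 : IsIso (prod.fst : X ⨯ ⊥_ C ⟶ X) :=
      ⟨prod.lift (𝟙 X) 0, by
        apply prod.hom_ext
        · simp [prod.lift_fst]
        · exact hsub _ _, prod.lift_fst _ _⟩
    infer_instance
  have a2 : IsIso (coprod.inr ≫ m X Y ≫ prod.snd) := by
    have e : coprod.inr ≫ m X Y ≫ prod.snd = coprod.inr ≫ m (⊥_ C) Y ≫ prod.snd := by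
      have := nat (0 : X ⟶ ⊥_ C) (𝟙 Y)
      have := congrArg (fun t => coprod.inr ≫ t ≫ prod.snd) this
      simpa using this.symm
    rw [e]
    have i1 : IsIso (coprod.inr : Y ⟶ (⊥_ C) ⨿ Y) :=
      ⟨coprod.desc 0 (𝟙 Y), coprod.inr_desc _ _, by
        apply coprod.hom_ext
        · exact h0.eq_of_src _ _
        · simp [coprod.inr_desc]⟩
    have i2 : IsIso (prod.snd : (⊥_ C) ⨯ Y ⟶ Y) :=
      ⟨prod.lift 0 (𝟙 Y), by
        apply prod.hom_ext
        · exact hsub _ _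
        · simp [prod.lift_snd], prod.lift_snd _ _⟩
    infer_instance
  -- the other entries
  have z1 : coprod.inl ≫ m X Y ≫ prod.snd = 0 := by
    have := congrArg (fun t => coprod.inl ≫ t ≫ prod.snd) (nat (𝟙 X) (0 : ⊥_ C ⟶ Y))
    simpa using this
  have z2 : coprod.inr ≫ m X Y ≫ prod.fst = 0 := by
    have := congrArg (fun t => coprod.inr ≫ t ≫ prod.fst) (nat (0 : ⊥_ C ⟶ X) (𝟙 Y))
    simpa using this
  have key : coprod.map (coprod.inl ≫ m X Y ≫ prod.fst) (coprod.inr ≫ m X Y ≫ prod.snd) ≫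
      coprod.desc (prod.lift (𝟙 X) 0) (prod.lift 0 (𝟙 Y)) = m X Y := by
    apply coprod.hom_ext <;> apply prod.hom_ext <;>
      simp [z1, z2, prod.lift_fst, prod.lift_snd, coprod.inl_desc, coprod.inr_desc]
  have : IsIso (coprod.map (coprod.inl ≫ m X Y ≫ prod.fst)
      (coprod.inr ≫ m X Y ≫ prod.snd)) := inferInstance
  exact IsIso.of_isIso_fac_left key

/-- The product carries the bicone; its colimit property is that of the coproduct, transported along
the canonical isomorphism. -/
theorem hasBinaryBiproducts_of_isIso_canonical [HasZeroMorphisms C]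
    (h : ∀ X Y : C, IsIso (coprod.desc (prod.lift (𝟙 X) 0) (prod.lift 0 (𝟙 Y)) :
      X ⨿ Y ⟶ X ⨯ Y)) : HasBinaryBiproducts C := by
  refine ⟨fun X Y => HasBinaryBiproduct.mk
    ⟨{ pt := X ⨯ Y, fst := prod.fst, snd := prod.snd,
       inl := prod.lift (𝟙 X) 0, inr := prod.lift 0 (𝟙 Y),
       inl_fst := prod.lift_fst _ _, inl_snd := prod.lift_snd _ _,
       inr_fst := prod.lift_fst _ _, inr_snd := prod.lift_snd _ _ }, ?_, ?_⟩⟩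
  · exact (prodIsProd X Y).ofIsoLimit (BinaryFan.ext (Iso.refl _) (by simp) (by simp))
  · exact (coprodIsCoprod X Y).ofIsoColimit (BinaryCofan.ext
      (@asIso _ _ _ _ _ (h X Y)) (coprod.inl_desc _ _) (coprod.inr_desc _ _))

open SemiadditiveOfBinaryBiproducts in
theorem cMonEnriched_of_natIso (ψ : (coprod.functor : C ⥤ C ⥤ C) ≅ prod.functor) :
    Nonempty (CMonEnriched C) := by
  have h0 := isZero_initial_of_natIso ψ
  let : HasZeroMorphisms C := h0.hasZeroMorphisms
  have := hasBinaryBiproducts_of_isIso_canonical (isIso_canonical_of_natIso h0 ψ)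
  exact ⟨{ addCommMonoid := addCommMonoidHomOfHasBinaryBiproducts
           add_comp := add_comp
           comp_add := comp_add
           zero_comp := fun _ => zero_comp
           comp_zero := fun _ => comp_zero }⟩

end NaturalIso

/-! ### Characterizations of additive categories. -/

theorem HasNaturallyIsoSumsProducts.exists_cMonEnriched {C : Type u} [Category.{v} C]
    (h : HasNaturallyIsoSumsProducts C) : Nonempty (CMonEnriched C) := by
  obtain ⟨_, _, ⟨ψ⟩⟩ := h
  exact cMonEnriched_of_natIso ψ

theorem additive_category_tfae (C : Type u) [Category.{v} C] :
    List.TFAE [∃ _ : CMonEnriched C, HasFiniteBiproducts C,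
      ∃ _ : CMonEnriched C, HasFiniteCoproducts C,
      HasNaturallyIsoSumsProducts C] := by
  tfae_have 1 → 2 := fun ⟨h, _⟩ => ⟨h, inferInstance⟩
  tfae_have 2 → 1 := fun ⟨h, _⟩ => ⟨h, hasFiniteBiproducts_of_hasFiniteCoproducts⟩
  tfae_have 1 → 3 := fun ⟨_, _⟩ => hasNaturallyIsoSumsProducts_of_hasFiniteBiproducts
  tfae_have 3 → 2 := fun h => by
    obtain ⟨e⟩ := h.exists_cMonEnriched
    exact ⟨e, h.1⟩
  tfae_finish

/-! ### Additive functors -/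

section AdditiveFunctors

variable {C D : Type u} [Category.{v} C] [Category.{v} D] [CMonEnriched C] [CMonEnriched D]
  {F : C ⥤ D}

/-- The total identity of a bicone is an equation between sums of composites, so an additive functor
carries it to the image bicone. -/
theorem IsAdditive.preservesBiproducts (hF : IsAdditive F) : PreservesBiproducts F := by
  have h0 : F.PreservesZeroMorphisms := ⟨fun X Y => hF.map_zero X Y⟩
  refine ⟨h0, ⟨fun {J} _ => ⟨fun {X} => ⟨fun {b} hb => ?_⟩⟩⟩⟩
  have := Fintype.ofFinite J
  have := congrArg F.map (total_of_isLimit b hb.isLimit)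
  rw [hF.map_sum, F.map_id] at this
  refine ⟨isBilimitOfTotal _ (Eq.trans (Finset.sum_congr rfl fun j _ => ?_) this)⟩
  exact (F.map_comp _ _).symm

/-- The image of the limit cone of a bicone is the limit cone of the image. -/
noncomputable def mapBiconeIsLimitEquiv [F.PreservesZeroMorphisms] {J : Type} {X : J → C}
    (b : Bicone X) : IsLimit (F.mapCone b.toCone) ≃ IsLimit (F.mapBicone b).toCone :=
  (IsLimit.postcomposeHomEquiv (Discrete.compNatIsoDiscrete X F) (F.mapCone b.toCone)).symm.trans
    (IsLimit.equivIsoLimit (Cone.ext (Iso.refl _) fun _ =>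
      (Category.comp_id _).trans (Category.id_comp _).symm))

/-- The image of the colimit cocone of a bicone is the colimit cocone of the image. -/
noncomputable def mapBiconeIsColimitEquiv [F.PreservesZeroMorphisms] {J : Type} {X : J → C}
    (b : Bicone X) : IsColimit (F.mapCocone b.toCocone) ≃ IsColimit (F.mapBicone b).toCocone :=
  (IsColimit.precomposeInvEquiv (Discrete.compNatIsoDiscrete X F)
    (F.mapCocone b.toCocone)).symm.trans
    (IsColimit.equivIsoColimit (Cocone.ext (Iso.refl _) fun _ =>
      (Category.comp_id _).trans (Category.id_comp _)))

theorem PreservesBiproducts.preservesFiniteProducts [HasFiniteBiproducts C]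
    (hF : PreservesBiproducts F) : PreservesFiniteProducts F := by
  obtain ⟨_, _⟩ := hF
  refine ⟨fun n => ⟨fun {K} => ?_⟩⟩
  have : PreservesLimit (Discrete.functor (K.obj ∘ Discrete.mk)) F := by
    have hb := biproduct.isBilimit (K.obj ∘ Discrete.mk)
    exact preservesLimit_of_preserves_limit_cone hb.isLimit
      ((mapBiconeIsLimitEquiv _).symm (isBilimitOfPreserves F hb).isLimit)
  exact preservesLimit_of_iso_diagram F Discrete.natIsoFunctor.symm

theorem PreservesBiproducts.preservesFiniteCoproducts [HasFiniteBiproducts C]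
    (hF : PreservesBiproducts F) : PreservesFiniteCoproducts F := by
  obtain ⟨_, _⟩ := hF
  refine ⟨fun n => ⟨fun {K} => ?_⟩⟩
  have : PreservesColimit (Discrete.functor (K.obj ∘ Discrete.mk)) F := by
    have hb := biproduct.isBilimit (K.obj ∘ Discrete.mk)
    exact preservesColimit_of_preserves_colimit_cocone hb.isColimit
      ((mapBiconeIsColimitEquiv _).symm (isBilimitOfPreserves F hb).isColimit)
  exact preservesColimit_of_iso_diagram F Discrete.natIsoFunctor.symm

/-- `f + g` is the diagonal of `X` followed by the copairing of `f` and `g`. Inserting the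
decomposed identity of `F (X ⊕ X)` between the two images splits `F.map (f + g)` into `F.map f` and
`F.map g`. -/
theorem isAdditive_of_total [HasFiniteBiproducts C] [F.PreservesZeroMorphisms]
    (h : ∀ X : C, ∑ j, (F.mapBicone (biproduct.bicone fun _ : Fin 2 => X)).π j ≫
      (F.mapBicone (biproduct.bicone fun _ : Fin 2 => X)).ι j = 𝟙 _) : IsAdditive F := by
  refine ⟨fun X Y => F.map_zero X Y, fun {X Y} f g => ?_⟩
  let b := biproduct.bicone fun _ : Fin 2 => X
  let φ : Fin 2 → (X ⟶ Y) := fun i => if i = 0 then f else g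
  have e : f + g = (∑ i, 𝟙 X ≫ b.ι i) ≫ ∑ i, b.π i ≫ φ i := by
    rw [comp_sum]
    simp_rw [← Category.assoc]
    simp_rw [sum_comp_ι_π b (fun _ => 𝟙 X)]
    simp [φ]
  have key : F.map (f + g) = F.map (∑ i, 𝟙 X ≫ b.ι i) ≫ (∑ j, F.map (b.π j) ≫ F.map (b.ι j)) ≫
      F.map (∑ i, b.π i ≫ φ i) := by
    have := h X
    rw [e, F.map_comp]
    simp only [Functor.mapBicone_π, Functor.mapBicone_ι] at this
    rw [show (∑ j, F.map (b.π j) ≫ F.map (b.ι j)) = 𝟙 _ from this, Category.id_comp]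
  have hφ : ∀ j, F.map (∑ i, 𝟙 X ≫ b.ι i) ≫ (F.map (b.π j) ≫ F.map (b.ι j)) ≫
      F.map (∑ i, b.π i ≫ φ i) = F.map (φ j) := by
    intro j
    rw [Category.assoc, ← F.map_comp (b.ι j), ι_comp_sum_π b φ, ← Category.assoc, ← F.map_comp,
      sum_comp_ι_π b (fun _ => 𝟙 X), F.map_id, Category.id_comp]
  rw [key, sum_comp, comp_sum, Fin.sum_univ_two, hφ, hφ]
  simp [φ]

theorem isAdditive_of_preservesFiniteProducts [HasFiniteBiproducts C]
    [HasFiniteBiproducts D] [PreservesFiniteProducts F] : IsAdditive F := by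
  -- With zero objects, preservation of the terminal object gives preservation of zero morphisms,
  -- which `isAdditive_of_total` presupposes.
  have : HasZeroObject C := hasZeroObject_of_hasFiniteBiproducts C
  have : HasZeroObject D := hasZeroObject_of_hasFiniteBiproducts D
  exact isAdditive_of_total fun X => total_of_isLimit _ (mapBiconeIsLimitEquiv _
    (isLimitOfPreserves F (biproduct.isBilimit fun _ : Fin 2 => X).isLimit))

theorem isAdditive_of_preservesFiniteCoproducts [HasFiniteBiproducts C]
    [HasFiniteBiproducts D] [PreservesFiniteCoproducts F] : IsAdditive F := by
  have : HasZeroObject C := hasZeroObject_of_hasFiniteBiproducts C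
  have : HasZeroObject D := hasZeroObject_of_hasFiniteBiproducts D
  exact isAdditive_of_total fun X => total_of_isColimit _ (mapBiconeIsColimitEquiv _
    (isColimitOfPreserves F (biproduct.isBilimit fun _ : Fin 2 => X).isColimit))

theorem additive_functor_tfae [HasFiniteCoproducts C] [HasFiniteCoproducts D] (F : C ⥤ D) :
    List.TFAE [IsAdditive F, PreservesBiproducts F, PreservesFiniteProducts F,
      PreservesFiniteCoproducts F] := by
  have : HasFiniteBiproducts C := hasFiniteBiproducts_of_hasFiniteCoproducts
  have : HasFiniteBiproducts D := hasFiniteBiproducts_of_hasFiniteCoproducts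
  tfae_have 1 → 2 := IsAdditive.preservesBiproducts
  tfae_have 2 → 3 := PreservesBiproducts.preservesFiniteProducts
  tfae_have 2 → 4 := PreservesBiproducts.preservesFiniteCoproducts
  tfae_have 3 → 1 := fun _ => isAdditive_of_preservesFiniteProducts
  tfae_have 4 → 1 := fun _ => isAdditive_of_preservesFiniteCoproducts
  tfae_finish

end AdditiveFunctors

/-! ### Functors between discrete cocone multicategories -/

namespace Multifunctor

variable {C D : Type u} [Category.{v} C] [Category.{v} D] (H : Multifunctor (cone C) (cone D))

/-- Composites have domains of length such as `∑ _ : Fin 1, 1`, which is `1` only up to a proof;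
this lets them be read as unary arrows. -/
theorem map_apply_of_eq_one {n : ℕ} (hn : n = 1) {X : Fin n → C} {Y : C} (f : ∀ i, X i ⟶ Y)
    (j : Fin n) : H.map (X := X) (Y := Y) f j =
      H.map (n := 1) (X := fun _ => X j) (Y := Y) (fun _ => f j) 0 := by
  subst hn
  obtain rfl : j = 0 := Subsingleton.elim _ _
  obtain ⟨x, rfl⟩ : ∃ x, X = fun _ => x :=
    ⟨X 0, funext fun i => congrArg X (Subsingleton.elim i 0)⟩
  obtain ⟨φ, rfl⟩ : ∃ φ, f = fun _ => φ :=
    ⟨f 0, funext fun i => congrArg f (Subsingleton.elim i 0)⟩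
  rfl

/-- The functor given by the action on unary arrows of a functor `C_▸ ⟶ D_▸`. -/
def unary : C ⥤ D where
  obj := H.obj
  map {X _} f := H.map (n := 1) (X := fun _ => X) (fun _ => f) 0
  map_id X := congrFun (H.map_id X) 0
  map_comp {X Y Z} f g := by
    have h := congrFun (H.map_comp (n := 1) (Y := fun _ => Y) (Z := Z) (k := fun _ => 1)
      (X := fun _ _ => X) (fun _ => g) (fun _ _ => f)) (finSigmaFinEquiv ⟨0, 0⟩)
    refine (Eq.trans ?_ h).trans ?_
    · exact (H.map_apply_of_eq_one (by simp) (X := concat fun _ _ => X) (Y := Z) (fun _ => f ≫ g)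
        (finSigmaFinEquiv (n := fun _ : Fin 1 => 1) ⟨0, 0⟩)).symm
    · change H.map (n := 1) (X := fun _ => X) (Y := Y) (fun _ => f) _ ≫
        H.map (n := 1) (X := fun _ => Y) (Y := Z) (fun _ => g) _ = _
      rw [Subsingleton.elim (finSigmaFinEquiv.symm _).1 (0 : Fin 1),
        Subsingleton.elim (finSigmaFinEquiv.symm _).2 (0 : Fin 1)]

/-- Composing `f` with the identity in place `i` and with empty sequences elsewhere leaves the unary
arrow `f i`; a functor respects this composition. -/
theorem map_apply {n : ℕ} {X : Fin n → C} {Y : C} (f : ∀ i, X i ⟶ Y) (i : Fin n) :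
    H.map (X := X) (Y := Y) f i = H.unary.map (f i) := by
  let k : Fin n → ℕ := fun j => if j = i then 1 else 0
  -- Stated for every length at most `1`, so as to apply to a block of length `k j` without first
  -- deciding whether `j = i`.
  have hid : ∀ (m : ℕ), m ≤ 1 → ∀ (X : C) (l : Fin m),
      H.map (n := m) (X := fun _ => X) (Y := X) (fun _ => 𝟙 X) l = 𝟙 (H.unary.obj X) := by
    intro m hm X l
    obtain rfl : m = 1 := by have := l.2; omega
    exact congrFun (H.map_id X) l
  have hk : ∑ j, k j = 1 := by simp [k]
  let J : Fin (∑ j, k j) := finSigmaFinEquiv ⟨i, ⟨0, by simp [k]⟩⟩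
  have h := congrFun (H.map_comp (Y := X) (Z := Y) (k := k) (X := fun j _ => X j) f
    (fun j _ => 𝟙 (X j))) J
  have h1 := H.map_apply_of_eq_one hk (X := concat fun j (_ : Fin (k j)) => X j) (Y := Y)
    (fun J => 𝟙 _ ≫ f (finSigmaFinEquiv.symm J).1) J
  have h2 : H.map (X := X) (Y := Y) f (finSigmaFinEquiv.symm J).1 =
      H.unary.map (f (finSigmaFinEquiv.symm J).1) := by
    refine Eq.trans ?_ ((h.symm.trans h1).trans
      (congrArg H.unary.map (Category.id_comp (f (finSigmaFinEquiv.symm J).1))))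
    refine (Category.id_comp _).symm.trans ?_
    refine congrArg (· ≫ H.map (X := X) (Y := Y) f (finSigmaFinEquiv.symm J).1) ?_
    refine (hid _ ?_ _ _).symm
    simp only [k]
    split_ifs <;> simp
  have e : (finSigmaFinEquiv.symm J).1 = i := by simp [J]
  exact e ▸ h2

end Multifunctor

/-! ### Full faithfulness of `C ↦ C_▸` on preadditive categories. -/

section FullyFaithful

variable {C : Type u} [Category.{v} C] [CMonEnriched C]

theorem coneAct_const {n : ℕ} {X Y : C} (f : Fin n → (X ⟶ Y)) :
    coneAct (fun _ => (0 : Fin 1)) (X := fun _ => X) (X' := fun _ => X) (fun _ => rfl) f 0 =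
      ∑ i, f i := by
  unfold coneAct
  refine Fintype.sum_bijective Subtype.val ⟨Subtype.val_injective, fun i => ⟨⟨i, rfl⟩, rfl⟩⟩ _ _
    fun i => ?_
  simp

variable {D : Type u} [Category.{v} D] [CMonEnriched D]

/-- The mapping `n → 1` acts on parallel arrows by adding them, and `K` commutes with it. The cases
`n = 0` and `n = 2` are additivity. -/
theorem FpFunctor.unary_map_sum (K : FpFunctor (fpCone C) (fpCone D)) {n : ℕ} {X Y : C}
    (f : Fin n → (X ⟶ Y)) :
    K.unary.map (∑ i, f i) = ∑ i, K.unary.map (f i) := by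
  have h := congrFun (K.map_act (n := n) (m := 1) (fun _ => 0) (X := fun _ => X)
    (X' := fun _ => X) (fun _ => rfl) (Y := Y) f) 0
  refine (congrArg K.unary.map (coneAct_const f)).symm.trans (Eq.trans ?_ (h.trans ?_))
  · exact (K.map_apply _ _).symm
  · refine (congrArg (fun g => coneAct (C := D) (fun _ => (0 : Fin 1)) (X := fun _ => K.obj X)
      (X' := fun _ => K.obj X) (fun _ => rfl) (Y := K.obj Y) g 0)
      (funext fun i => K.map_apply (X := fun _ => X) (Y := Y) f i)).trans ?_
    exact coneAct_const (C := D) fun i => K.unary.map (f i)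

theorem FpFunctor.unary_isAdditive (K : FpFunctor (fpCone C) (fpCone D)) :
    IsAdditive (C := C) (D := D) K.unary where
  map_zero X Y := by simpa using K.unary_map_sum (X := X) (Y := Y) (n := 0) Fin.elim0
  map_add {X Y} f g := by
    simpa using K.unary_map_sum (X := X) (Y := Y) (n := 2) (fun i => if i = 0 then f else g)

end FullyFaithful

instance : fpConeFunctor.{v, u}.Faithful where
  -- The unary part of the image of an additive functor is definitionally that functor.
  map_injective {C D _ _} h :=
    Subtype.ext (congrArg (fun K : FpFunctor (fpCone C.carrier) (fpCone D.carrier) =>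
      K.unary) h)

instance : fpConeFunctor.{v, u}.Full where
  map_surjective {C D} K := by
    refine ⟨⟨_, FpFunctor.unary_isAdditive (C := C.carrier) (D := D.carrier) K⟩,
      FpFunctor.ext rfl (heq_of_eq ?_)⟩
    funext n X Y f
    exact funext fun i => (K.map_apply (C := C.carrier) (D := D.carrier) f i).symm

/-! ### Isomorphisms of multicategories and transport of fp-structures -/

section Transport

/-- For an isomorphism the composite functors are only propositionally identities. Substituting the
whole functor avoids transport along equalities of objects. -/
theorem Multifunctor.map_bijective_of_eq_id {M : Multicat.{v, u}} {T : Multifunctor M M}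
    (hT : T = 𝟙 M) {n : ℕ} (X : Fin n → M.Ob) (Y : M.Ob) :
    Function.Bijective (T.map : M.Hom X Y → _) := by
  subst hT
  exact Function.bijective_id

theorem Multifunctor.map_act_of_eq_id {M : CartMulticat.{v, u}}
    {T : Multifunctor M.toMulticat M.toMulticat} (hT : T = 𝟙 M.toMulticat)
    {n m : ℕ} (p : Fin n → Fin m) {X : Fin n → M.Ob} {X' : Fin m → M.Ob}
    (h : ∀ i, X i = X' (p i)) {Y : M.Ob} (f : M.Hom X Y) :
    T.map (M.act p h f) = M.act p (fun i => congrArg T.obj (h i)) (T.map f) := by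
  subst hT
  rfl

variable {M N : Multicat.{v, u}}

theorem map_bijective_of_iso (e : M ≅ N) {n : ℕ} (X : Fin n → M.Ob) (Y : M.Ob) :
    Function.Bijective (Multifunctor.map e.hom : M.Hom X Y → N.Hom _ _) := by
  have h1 := fun {n : ℕ} (X : Fin n → M.Ob) (Y : M.Ob) =>
    Multifunctor.map_bijective_of_eq_id e.hom_inv_id X Y
  have h2 := fun {n : ℕ} (X : Fin n → N.Ob) (Y : N.Ob) =>
    Multifunctor.map_bijective_of_eq_id e.inv_hom_id X Y
  refine ⟨fun f g h => (h1 X Y).1 (congrArg (Multifunctor.map e.inv) h), fun y => ?_⟩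
  -- Only the two round trips are known to be bijective: surjectivity of the first supplies the
  -- preimage, injectivity of the second identifies its image with `y`.
  obtain ⟨x, hx⟩ := (h1 X Y).2 (Multifunctor.map e.inv y)
  exact ⟨x, (h2 _ _).1 (congrArg (Multifunctor.map e.hom) hx)⟩

theorem obj_surjective_of_iso (e : M ≅ N) : Function.Surjective (Multifunctor.obj e.hom) :=
  fun Y => ⟨Multifunctor.obj e.inv Y,
    congrFun (congrArg Multifunctor.obj (e.inv_hom_id : _ = 𝟙 N)) Y⟩

/-- Every object of `N` is an image, and the bijections on arrows intertwine composition with `t`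
and composition with its image. -/
theorem preUniversal_map_iff (e : M ≅ N) {n : ℕ} {X : Fin n → M.Ob} {T : M.Ob} (t : M.Hom X T) :
    N.PreUniversal (Multifunctor.map e.hom t) ↔ M.PreUniversal t := by
  refine (obj_surjective_of_iso e).forall.trans (forall_congr' fun Z => ?_)
  have h : (Multifunctor.map e.hom ∘
        fun f : M.Hom (fun _ : Fin 1 => T) Z => M.comp f fun _ : Fin 1 => t) =
      (fun f => N.comp f fun _ : Fin 1 => Multifunctor.map e.hom t) ∘ Multifunctor.map e.hom :=
    funext fun f => Multifunctor.map_comp e.hom f fun _ => t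
  rw [← (map_bijective_of_iso e (fun _ : Fin 1 => T) Z).of_comp_iff, ← h,
    (map_bijective_of_iso e _ Z).of_comp_iff']

theorem exists_preUniversal_of_iso (e : M ≅ N) (hN : N.IsRepresentable) {n : ℕ}
    (X : Fin n → M.Ob) : ∃ (T : M.Ob) (t : M.Hom X T), M.PreUniversal t := by
  obtain ⟨T, t, ht⟩ := hN.exists_preUniversal fun i => Multifunctor.obj e.hom (X i)
  obtain ⟨T, rfl⟩ := obj_surjective_of_iso e T
  obtain ⟨t, rfl⟩ := (map_bijective_of_iso e X T).2 t
  exact ⟨T, t, (preUniversal_map_iff e t).1 ht⟩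

theorem isRepresentable_of_iso (e : M ≅ N) (hN : N.IsRepresentable) : M.IsRepresentable where
  exists_preUniversal := exists_preUniversal_of_iso e hN
  comp_preUniversal f g hf hg := by
    rw [← preUniversal_map_iff e, Multifunctor.map_comp]
    exact hN.comp_preUniversal _ _ ((preUniversal_map_iff e f).2 hf)
      fun i => (preUniversal_map_iff e (g i)).2 (hg i)

instance : underlying.{v, u}.Faithful where
  map_injective {M N} F G h := by
    obtain ⟨F, _⟩ := F
    obtain ⟨G, _⟩ := G
    obtain rfl : F = G := h
    rfl

instance : underlying.{v, u}.ReflectsIsomorphisms where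
  reflects {M N} K _ := by
    let e := asIso (underlying.map K)
    have hinj := fun {n : ℕ} (X : Fin n → M.Ob) (Y : M.Ob) => (map_bijective_of_iso e X Y).1
    -- The inverse functor respects the actions automatically: after applying the injective map of
    -- `K`, both sides become the action in `N`.
    let I : FpFunctor N M :=
      { (show Multifunctor N.toMulticat M.toMulticat from e.inv) with
        map_act := fun p _ _ h _ f => by
          refine hinj _ _ ?_
          refine (Multifunctor.map_act_of_eq_id e.inv_hom_id p h f).trans ?_
          exact (FpFunctor.map_act K p _ _).symm }
    exact ⟨I, underlying.map_injective e.hom_inv_id, underlying.map_injective e.inv_hom_id⟩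

/-- An fp-structure on a multicategory. -/
structure FpStructure (M : Multicat.{v, u}) where
  act : ∀ {n m : ℕ} (p : Fin n → Fin m) {X : Fin n → M.Ob} {X' : Fin m → M.Ob}
    (_ : ∀ i, X i = X' (p i)) {Y : M.Ob}, M.Hom X Y → M.Hom X' Y
  act_id : ∀ {n : ℕ} {X : Fin n → M.Ob} {Y : M.Ob} (f : M.Hom X Y),
    act (fun i => i) (fun _ => rfl) f = f
  act_comp : ∀ {n m r : ℕ} (p : Fin n → Fin m) (q : Fin m → Fin r) {X : Fin n → M.Ob}
    {X' : Fin m → M.Ob} {X'' : Fin r → M.Ob} (hp : ∀ i, X i = X' (p i))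
    (hq : ∀ i, X' i = X'' (q i)) {Y : M.Ob} (f : M.Hom X Y),
    act (fun i => q (p i)) (fun i => (hp i).trans (hq (p i))) f = act q hq (act p hp f)
  comp_act : ∀ {n : ℕ} {Y : Fin n → M.Ob} {Z : M.Ob} {k k' : Fin n → ℕ}
    {X : ∀ i, Fin (k i) → M.Ob} {X' : ∀ i, Fin (k' i) → M.Ob}
    (p : ∀ i, Fin (k i) → Fin (k' i)) (hp : ∀ i l, X i l = X' i (p i l))
    (f : M.Hom Y Z) (g : ∀ i, M.Hom (X i) (Y i)),
    M.comp f (fun i => act (p i) (hp i) (g i)) =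
      act (sumMap p) (concat_sumMap p hp) (M.comp f g)
  act_comp_eq : ∀ {n m : ℕ} (p : Fin n → Fin m) {Y : Fin m → M.Ob} {Z : M.Ob} {k : Fin m → ℕ}
    {X : ∀ j, Fin (k j) → M.Ob} (f : M.Hom (fun i => Y (p i)) Z) (g : ∀ j, M.Hom (X j) (Y j)),
    M.comp (act p (fun _ => rfl) f) g =
      act (blockMap p k) (concat_blockMap p X) (M.comp f (fun i => g (p i)))

/-- The cartesian multicategory given by an fp-structure. -/
def FpStructure.toCartMulticat (A : FpStructure M) : CartMulticat.{v, u} :=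
  { M with
    act := A.act
    act_id := A.act_id
    act_comp := A.act_comp
    comp_act := A.comp_act
    act_comp_eq := A.act_comp_eq }

/-- The transport of an fp-structure along a fully faithful functor of multicategories. -/
noncomputable def FpStructure.pullback {N : CartMulticat.{v, u}} (H : Multifunctor M N.toMulticat)
    (hH : ∀ {n : ℕ} (X : Fin n → M.Ob) (Y : M.Ob), Function.Bijective (H.map : M.Hom X Y → _)) :
    FpStructure M :=
  let act {n m : ℕ} (p : Fin n → Fin m) {X : Fin n → M.Ob} {X' : Fin m → M.Ob}
      (h : ∀ i, X i = X' (p i)) {Y : M.Ob} (f : M.Hom X Y) : M.Hom X' Y :=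
    (Equiv.ofBijective _ (hH X' Y)).symm (N.act p (fun i => congrArg H.obj (h i)) (H.map f))
  have map_act {n m : ℕ} (p : Fin n → Fin m) {X : Fin n → M.Ob} {X' : Fin m → M.Ob}
      (h : ∀ i, X i = X' (p i)) {Y : M.Ob} (f : M.Hom X Y) :
      H.map (act p h f) = N.act p (fun i => congrArg H.obj (h i)) (H.map f) :=
    (Equiv.ofBijective _ (hH X' Y)).apply_symm_apply _
  { act := act
    -- Each law is checked after applying the injective `H.map`, where it becomes the law of `N`.
    act_id := fun f => (hH _ _).1 ((map_act _ (fun _ => rfl) f).trans (N.act_id _))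
    act_comp := fun p q _ _ _ hp hq _ f => (hH _ _).1 <| by
      rw [map_act _ fun i => (hp i).trans (hq (p i)), map_act q hq, map_act p hp]
      exact N.act_comp p q _ _ _
    comp_act := fun p hp f g => (hH _ _).1 <| by
      rw [map_act _ (concat_sumMap p hp), H.map_comp, H.map_comp]
      simp only [map_act]
      exact N.comp_act p _ _ _
    act_comp_eq := fun p _ _ k X f g => (hH _ _).1 <| by
      rw [map_act _ (concat_blockMap p X), H.map_comp, map_act p (fun _ => rfl), H.map_comp]
      exact N.act_comp_eq p _ _ }

theorem FpStructure.map_pullback_act {N : CartMulticat.{v, u}} (H : Multifunctor M N.toMulticat)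
    (hH : ∀ {n : ℕ} (X : Fin n → M.Ob) (Y : M.Ob), Function.Bijective (H.map : M.Hom X Y → _))
    {n m : ℕ} (p : Fin n → Fin m) {X : Fin n → M.Ob} {X' : Fin m → M.Ob}
    (h : ∀ i, X i = X' (p i)) {Y : M.Ob} (f : M.Hom X Y) :
    H.map ((FpStructure.pullback H hH).act p h f) =
      N.act p (fun i => congrArg H.obj (h i)) (H.map f) :=
  (Equiv.ofBijective _ (hH X' Y)).apply_symm_apply
    (N.act p (fun i => congrArg H.obj (h i)) (H.map f))

/-- A cartesian multicategory whose underlying multicategory is isomorphic to `M` is isomorphic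
to one given by an fp-structure on `M`. -/
theorem exists_fpStructure_iso {N : CartMulticat.{v, u}} (e : M ≅ N.toMulticat) :
    ∃ A : FpStructure M, Nonempty (A.toCartMulticat ≅ N) := by
  let A := FpStructure.pullback (N := N) e.hom fun X Y => map_bijective_of_iso e X Y
  let K : A.toCartMulticat ⟶ N :=
    { (show Multifunctor M N.toMulticat from e.hom) with
      map_act := fun p _ _ h _ f => FpStructure.map_pullback_act (N := N) e.hom
        (fun X Y => map_bijective_of_iso e X Y) p h f }
  have : IsIso (underlying.map K) := e.isIso_hom
  have : IsIso K := isIso_of_reflects_iso K underlying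
  exact ⟨A, ⟨asIso K⟩⟩

end Transport

/-! ### Representability of discrete cocone multicategories -/

section Representable

variable {C : Type u} [Category.{v} C]

theorem comp_bijective {A B : Type} (e : A ≃ B) (P : B → Type v) :
    Function.Bijective fun (f : ∀ b, P b) (a : A) => f (e a) :=
  (Equiv.piCongrLeft P e).symm.bijective

/-- Pre-universality in `C_▸` is the universal property of a coproduct cocone; only the one-block
enumeration of the domain and the one-element sequences of arrows have to be unwound. -/
theorem preUniversal_cone_iff {n : ℕ} {X : Fin n → C} {T : C} (t : ∀ i, X i ⟶ T) :
    (cone C).PreUniversal (X := X) (T := T) t ↔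
      ∀ Z, Function.Bijective fun (h : T ⟶ Z) (i : Fin n) => t i ≫ h := by
  refine forall_congr' fun Z => ?_
  let r : Fin (∑ _ : Fin 1, n) ≃ Fin n :=
    finSigmaFinEquiv.symm.trans ((Equiv.sigmaEquivProd _ _).trans (Equiv.uniqueProd _ _))
  have h1 : Function.Bijective fun (f : (cone C).Hom (fun _ : Fin 1 => T) Z) => f 0 :=
    (Equiv.funUnique (Fin 1) (T ⟶ Z)).bijective
  have e : (fun f : (cone C).Hom (fun _ : Fin 1 => T) Z =>
        (cone C).comp f (fun _ : Fin 1 => (show (cone C).Hom X T from t))) =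
      (fun (f : ∀ i, X i ⟶ Z) j => f (r j)) ∘ (fun (h : T ⟶ Z) (i : Fin n) => t i ≫ h) ∘
        fun f => f 0 := by
    funext f j
    exact congrArg (fun a => t (r j) ≫ f a) (Subsingleton.elim _ _)
  refine (iff_of_eq (congrArg Function.Bijective e)).trans ?_
  exact ((comp_bijective r fun i => X i ⟶ Z).of_comp_iff' _).trans (h1.of_comp_iff _)

/-- A coproduct of coproducts is a coproduct, so the closure condition in representability is
automatic for `C_▸`. -/
theorem preUniversal_cone_comp {n : ℕ} {Y : Fin n → C} {Z : C} {k : Fin n → ℕ}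
    {X : ∀ i, Fin (k i) → C} (f : ∀ i, Y i ⟶ Z) (g : ∀ i l, X i l ⟶ Y i)
    (hf : (cone C).PreUniversal (X := Y) (T := Z) f)
    (hg : ∀ i, (cone C).PreUniversal (X := X i) (T := Y i) (g i)) :
    (cone C).PreUniversal ((cone C).comp (X := X) (Y := Y) (Z := Z) f g) := by
  rw [preUniversal_cone_iff] at hf
  simp only [preUniversal_cone_iff] at hg
  refine (preUniversal_cone_iff (X := concat X) _).2 fun W => ⟨fun h h' hh => ?_, fun w => ?_⟩
  · have key : ∀ s : (Σ i, Fin (k i)),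
        (g s.1 s.2 ≫ f s.1) ≫ h = (g s.1 s.2 ≫ f s.1) ≫ h' :=
      finSigmaFinEquiv.symm.surjective.forall.2 fun J => congrFun hh J
    refine (hf W).1 (funext fun i => (hg i W).1 (funext fun l => ?_))
    simpa using key ⟨i, l⟩
  · obtain ⟨w, rfl⟩ := (comp_bijective finSigmaFinEquiv.symm
      fun s : (Σ i, Fin (k i)) => X s.1 s.2 ⟶ W).2 w
    choose y hy using fun i => (hg i W).2 fun l => w ⟨i, l⟩
    obtain ⟨h, rfl⟩ := (hf W).2 y
    refine ⟨h, funext fun J => (Category.assoc _ _ _).trans ?_⟩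
    exact congrFun (hy (finSigmaFinEquiv.symm J).1) (finSigmaFinEquiv.symm J).2

theorem cone_isRepresentable [HasFiniteCoproducts C] : (cone C).IsRepresentable where
  exists_preUniversal {n} (X : Fin n → C) := by
    refine ⟨(∐ X : C), Sigma.ι (C := C) X, (preUniversal_cone_iff _).2 fun Z => ⟨?_, ?_⟩⟩
    · intro h h' hh
      exact Sigma.hom_ext _ _ fun i => congrFun hh i
    · intro f
      exact ⟨Sigma.desc f, funext fun i => Sigma.ι_desc _ _⟩
  comp_preUniversal f g hf hg := preUniversal_cone_comp f g hf hg

theorem hasFiniteCoproducts_of_preUniversal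
    (h : ∀ {n : ℕ} (X : Fin n → C), ∃ (T : C) (t : (cone C).Hom X T), (cone C).PreUniversal t) :
    HasFiniteCoproducts C := by
  refine ⟨fun n => ⟨fun K => ?_⟩⟩
  have (X : Fin n → C) : HasColimit (Discrete.functor X) := by
    obtain ⟨T, t, ht⟩ := h X
    have ht := (preUniversal_cone_iff (X := X) t).1 ht
    refine ⟨⟨⟨Cofan.mk T t, Cofan.IsColimit.mk _ (fun s => Classical.choose ((ht s.pt).2 s.inj))
      (fun s j => congrFun (Classical.choose_spec ((ht s.pt).2 s.inj)) j) fun s m hm => ?_⟩⟩⟩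
    refine (ht s.pt).1 ?_
    rw [Classical.choose_spec ((ht s.pt).2 s.inj)]
    exact funext hm
  exact hasColimit_of_iso Discrete.natIsoFunctor

end Representable

theorem fpSum_fpCone (C : Type u) [Category.{v} C] [CMonEnriched C] [HasFiniteCoproducts C] :
    fpSum (fpCone C) :=
  ⟨⟨C, inferInstance, ⟨Iso.refl _⟩⟩, cone_isRepresentable⟩

/-! ### The fp-structures on a discrete cocone multicategory -/

namespace FpStructure

variable {C : Type u} [Category.{v} C] (A : FpStructure (cone C))

/-- The action of a mapping on a sequence of concurrent arrows. -/
def op {n m : ℕ} (p : Fin n → Fin m) {X : Fin n → C} {X' : Fin m → C}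
    (h : ∀ i, X i = X' (p i)) {Y : C} (f : ∀ i, X i ⟶ Y) : ∀ j, X' j ⟶ Y :=
  A.act p (X := X) (X' := X') h (Y := Y) f

/-- Compares actions whose index sets agree only up to a cast, as happens with blocks of total
length `∑ _ : Fin 1, n` or `∑ _ : Fin n, 1`. -/
theorem op_heq {n n' m m' : ℕ} (hn : n = n') (hm : m = m') {p : Fin n → Fin m}
    {p' : Fin n' → Fin m'} (hp : ∀ i, Fin.cast hm (p i) = p' (Fin.cast hn i))
    {X : Fin n → C} {X' : Fin m → C} {W : Fin n' → C} {W' : Fin m' → C}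
    (hX : ∀ i, X i = W (Fin.cast hn i)) (hX' : ∀ j, X' j = W' (Fin.cast hm j))
    (h : ∀ i, X i = X' (p i)) (h' : ∀ i, W i = W' (p' i)) {Y : C} (f : ∀ i, X i ⟶ Y)
    (g : ∀ i, W i ⟶ Y) (hf : ∀ i, HEq (f i) (g (Fin.cast hn i))) (j : Fin m) :
    HEq (A.op p h f j) (A.op p' h' g (Fin.cast hm j)) := by
  subst hn hm
  obtain rfl : p = p' := funext hp
  obtain rfl : X = W := funext hX
  obtain rfl : X' = W' := funext hX'
  obtain rfl : f = g := funext fun i => eq_of_heq (hf i)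
  rfl

theorem op_id {n : ℕ} {X : Fin n → C} {Y : C} (p : Fin n → Fin n) (hp : ∀ i, p i = i)
    (h : ∀ i, X i = X (p i)) (f : ∀ i, X i ⟶ Y) : A.op p h f = f := by
  obtain rfl : p = fun i => i := funext hp
  exact A.act_id (X := X) (Y := Y) f

theorem op_op {n m r : ℕ} (p : Fin n → Fin m) (q : Fin m → Fin r) {X : Fin n → C}
    {X' : Fin m → C} {X'' : Fin r → C} (hp : ∀ i, X i = X' (p i))
    (hq : ∀ i, X' i = X'' (q i)) {Y : C} (f : ∀ i, X i ⟶ Y) :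
    A.op q hq (A.op p hp f) =
      A.op (fun i => q (p i)) (fun i => (hp i).trans (hq (p i))) f :=
  (A.act_comp p q (X := X) (X' := X') (X'' := X'') hp hq (Y := Y) f).symm

theorem symm_snd_eq_cast {n : ℕ} (j : Fin (∑ _ : Fin 1, n)) :
    (finSigmaFinEquiv.symm j).2 = Fin.cast (by simp) j := by
  obtain ⟨s, rfl⟩ := finSigmaFinEquiv.surjective j
  ext
  rw [Equiv.symm_apply_apply, Fin.val_cast, finSigmaFinEquiv_one]

theorem symm_fst_eq_cast {n : ℕ} (j : Fin (∑ _ : Fin n, 1)) :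
    (finSigmaFinEquiv.symm j).1 = Fin.cast (by simp) j := by
  obtain ⟨s, rfl⟩ := finSigmaFinEquiv.surjective j
  ext
  rw [Equiv.symm_apply_apply, Fin.val_cast, finSigmaFinEquiv_apply]
  simp

/-- Naturality of the action in the codomain. -/
theorem op_comp {n m : ℕ} (p : Fin n → Fin m) {X : Fin n → C} {X' : Fin m → C}
    (h : ∀ i, X i = X' (p i)) {Y Z : C} (f : ∀ i, X i ⟶ Y) (g : Y ⟶ Z) (j : Fin m) :
    A.op p h f j ≫ g = A.op p h (fun i => f i ≫ g) j := by
  -- With a unary outer arrow there is a single block, and `sumMap` is `p` up to a cast.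
  have key := A.comp_act (n := 1) (Y := fun _ => Y) (Z := Z) (k := fun _ => n) (k' := fun _ => m)
    (X := fun _ => X) (X' := fun _ => X') (fun _ => p) (fun _ => h) (fun _ => g) (fun _ => f)
  let J : Fin (∑ _ : Fin 1, m) := Fin.cast (by simp) j
  have hJ : (finSigmaFinEquiv.symm J).2 = j := symm_snd_eq_cast J
  have h1 : HEq (A.op p h f (finSigmaFinEquiv.symm J).2 ≫ g)
      (A.op p h (fun i => f i ≫ g) (Fin.cast (by simp) J)) := by
    refine (heq_of_eq (congrFun key J)).trans ?_
    refine A.op_heq (by simp) (by simp) (fun i => ?_) (fun i => ?_) (fun i => ?_)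
      (concat_sumMap (fun _ => p) fun _ => h) h _ _ (fun i => ?_) J
    · rw [← symm_snd_eq_cast, ← symm_snd_eq_cast, sumMap, Equiv.symm_apply_apply]
    · exact congrArg X (symm_snd_eq_cast i)
    · exact congrArg X' (symm_snd_eq_cast i)
    · exact congr_arg_heq (fun l => f l ≫ g) (symm_snd_eq_cast i)
  rw [hJ] at h1
  exact eq_of_heq h1

/-- Naturality of the action in the domains. -/
theorem comp_op {n m : ℕ} (p : Fin n → Fin m) {X Y : Fin m → C} {Z : C}
    (u : ∀ j, X j ⟶ Y j) (f : ∀ i, Y (p i) ⟶ Z) (j : Fin m) :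
    u j ≫ A.op p (fun _ => rfl) f j =
      A.op p (X := fun i => X (p i)) (fun _ => rfl) (fun i => u (p i) ≫ f i) j := by
  -- With unary inner arrows all blocks have length one, and `blockMap` is `p` up to a cast.
  have key := A.act_comp_eq p (Y := Y) (Z := Z) (k := fun _ => 1) (X := fun j _ => X j) f
    (fun j _ => u j)
  let J : Fin (∑ _ : Fin m, 1) := Fin.cast (by simp) j
  have hJ : (finSigmaFinEquiv.symm J).1 = j := symm_fst_eq_cast J
  have h1 : HEq (u (finSigmaFinEquiv.symm J).1 ≫
        A.op p (X' := Y) (fun _ => rfl) f (finSigmaFinEquiv.symm J).1)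
      (A.op p (X := fun i => X (p i)) (X' := X) (fun _ => rfl) (fun i => u (p i) ≫ f i)
        (Fin.cast (by simp) J)) := by
    refine (heq_of_eq (congrFun key J)).trans ?_
    refine A.op_heq (show ∑ _ : Fin n, 1 = n by simp) (show ∑ _ : Fin m, 1 = m by simp)
      (fun i => ?_) (fun i => ?_) (fun i => ?_)
      (concat_blockMap p (k := fun _ => 1) fun j _ => X j) (fun _ => rfl) _ _ (fun i => ?_) J
    · rw [← symm_fst_eq_cast, ← symm_fst_eq_cast, blockMap, Equiv.symm_apply_apply]
    · exact congrArg (fun i => X (p i)) (symm_fst_eq_cast i)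
    · exact congrArg X (symm_fst_eq_cast i)
    · exact congr_arg_heq (fun i => u (p i) ≫ f i) (symm_fst_eq_cast i)
  rw [hJ] at h1
  exact eq_of_heq h1

/-- The zero arrow, obtained from the empty sequence of arrows. -/
def zero (X Y : C) : X ⟶ Y :=
  A.op (n := 0) (m := 1) Fin.elim0 (X := fun _ => X) (X' := fun _ => X) (fun _ => rfl)
    (fun i => i.elim0) 0

theorem zero_comp (X : C) {Y Z : C} (g : Y ⟶ Z) : A.zero X Y ≫ g = A.zero X Z := by
  rw [zero, op_comp]
  exact congrFun (congrArg _ (funext fun i => i.elim0)) 0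

theorem comp_zero {X Y : C} (f : X ⟶ Y) (Z : C) : f ≫ A.zero Y Z = A.zero X Z := by
  refine (A.comp_op (m := 1) Fin.elim0 (X := fun _ => X) (Y := fun _ => Y) (fun _ => f)
    _ 0).trans ?_
  exact congrFun (congrArg _ (funext fun i => i.elim0)) 0

/-- The arrow at which the `j`-th component of an action can be computed, by composing with
identities in the `j`-th place and with empty sequences elsewhere. -/
theorem op_apply_heq {n m : ℕ} (p : Fin n → Fin m) {X : Fin m → C} {Y : C}
    (f : ∀ i, X (p i) ⟶ Y) (j : Fin m) {N : ℕ}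
    (hN : ∑ i, (if p i = j then 1 else 0) = N) (g : ∀ _ : Fin N, X j ⟶ Y)
    (hg : ∀ i (l : Fin N), p i = j → HEq (f i) (g l)) :
    A.op p (X' := X) (fun _ => rfl) f j =
      A.op (m := 1) (fun _ => 0) (X := fun _ => X j) (X' := fun _ => X j) (fun _ => rfl) g 0 := by
  -- One identity over `j`, nothing elsewhere: the composite keeps only the component `j`, and on
  -- the other side only the indices in the fibre of `p` over `j`, which number `N`.
  let k : Fin m → ℕ := fun j' => if j' = j then 1 else 0
  have hk : ∑ j, k j = 1 := by simp [k]
  have hkj : ∀ s : (Σ i, Fin (k i)), s.1 = j := by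
    rintro ⟨i, l⟩
    by_contra hi
    have := l.2
    simp [k, hi] at this
  let J : Fin (∑ j, k j) := Fin.cast hk.symm 0
  have key := congrFun (A.act_comp_eq p (Y := X) (Z := Y) (k := k) (X := fun j _ => X j) f
    (fun j _ => 𝟙 (X j))) J
  have h1 : HEq (A.op p (X' := X) (fun _ => rfl) f (finSigmaFinEquiv.symm J).1)
      (A.op (m := 1) (fun _ => 0) (X := fun _ => X j) (X' := fun _ => X j) (fun _ => rfl) g
        (Fin.cast hk J)) := by
    refine (heq_of_eq ((Category.id_comp _).symm.trans key)).trans ?_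
    refine A.op_heq hN hk (fun i => Subsingleton.elim _ _) (fun i => ?_) (fun i => ?_)
      (concat_blockMap p (k := k) fun j _ => X j) (fun _ => rfl) _ _ (fun i => ?_) J
    · exact congrArg X (hkj ⟨p (finSigmaFinEquiv.symm i).1, (finSigmaFinEquiv.symm i).2⟩)
    · exact congrArg X (hkj (finSigmaFinEquiv.symm i))
    · exact (heq_of_eq (Category.id_comp _)).trans
        (hg _ _ (hkj ⟨p (finSigmaFinEquiv.symm i).1, (finSigmaFinEquiv.symm i).2⟩))
  rw [hkj] at h1
  exact eq_of_heq h1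

/-- The fibre over `j` has one element; over any other index it is empty, which gives the zero arrow
in the companion lemma. -/
theorem op_single_self {m : ℕ} (j : Fin m) {X : Fin m → C} {Y : C} (f : X j ⟶ Y) :
    A.op (n := 1) (fun _ => j) (X := fun _ => X j) (X' := X) (fun _ => rfl) (fun _ => f) j = f := by
  rw [A.op_apply_heq (fun _ => j) (fun _ => f) j (N := 1) (by simp) (fun _ => f)
    (fun _ _ _ => HEq.rfl), A.op_id _ (fun _ => Subsingleton.elim _ _)]

theorem op_single_of_ne {m : ℕ} (j : Fin m) {X : Fin m → C} {Y : C} (f : X j ⟶ Y) {j' : Fin m}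
    (hj : j' ≠ j) :
    A.op (n := 1) (fun _ => j) (X := fun _ => X j) (X' := X) (fun _ => rfl) (fun _ => f) j' =
      A.zero (X j') Y := by
  rw [A.op_apply_heq (fun _ => j) (fun _ => f) j' (N := 0) (by simp [hj.symm]) (fun i => i.elim0)
    (fun _ l => l.elim0), zero]
  congr
  exact funext fun i => i.elim0

/-- The sum of two parallel arrows. -/
def add {X Y : C} (f g : X ⟶ Y) : X ⟶ Y :=
  A.op (n := 2) (m := 1) (fun _ => 0) (X := fun _ => X) (X' := fun _ => X) (fun _ => rfl)
    (fun i => if i = 0 then f else g) 0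

theorem add_comp {X Y Z : C} (f f' : X ⟶ Y) (g : Y ⟶ Z) :
    A.add f f' ≫ g = A.add (f ≫ g) (f' ≫ g) := by
  rw [add, op_comp]
  simp only [ite_comp]
  rfl

theorem comp_add {X Y Z : C} (f : X ⟶ Y) (g g' : Y ⟶ Z) :
    f ≫ A.add g g' = A.add (f ≫ g) (f ≫ g') := by
  refine (A.comp_op (m := 1) (fun _ => 0) (X := fun _ => X) (Y := fun _ => Y) (fun _ => f)
    _ 0).trans ?_
  simp only [comp_ite]
  rfl

/-- The pair `(f, 0)` is the image of `(f)` under a mapping `1 → 2`, and the composite `1 → 2 → 1`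
is the identity. -/
theorem add_zero {X Y : C} (f : X ⟶ Y) : A.add f (A.zero X Y) = f := by
  have e : (fun i : Fin 2 => if i = 0 then f else A.zero X Y) =
      A.op (n := 1) (fun _ => 0) (X := fun _ => X) (X' := fun _ => X) (fun _ => rfl)
        (fun _ => f) := by
    funext i
    split_ifs with hi
    · subst hi
      exact (A.op_single_self (X := fun _ => X) (0 : Fin 2) f).symm
    · exact (A.op_single_of_ne (X := fun _ => X) (0 : Fin 2) f hi).symm
  rw [add, e, op_op, A.op_id _ fun _ => Subsingleton.elim _ _]

theorem zero_add {X Y : C} (f : X ⟶ Y) : A.add (A.zero X Y) f = f := by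
  have e : (fun i : Fin 2 => if i = 0 then A.zero X Y else f) =
      A.op (n := 1) (fun _ => 1) (X := fun _ => X) (X' := fun _ => X) (fun _ => rfl)
        (fun _ => f) := by
    funext i
    split_ifs with hi
    · subst hi
      exact (A.op_single_of_ne (X := fun _ => X) (1 : Fin 2) f (by decide)).symm
    · obtain rfl : i = 1 := by omega
      exact (A.op_single_self (X := fun _ => X) (1 : Fin 2) f).symm
  rw [add, e, op_op, A.op_id _ fun _ => Subsingleton.elim _ _]

/-- The sum of `a` and `b` is one fixed arrow `inl + inr` followed by their copairing. Since
copairing commutes with addition, bilinearity gives the interchange law. -/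
theorem add_add_add_comm [HasFiniteCoproducts C] {X Y : C} (a b c d : X ⟶ Y) :
    A.add (A.add a b) (A.add c d) = A.add (A.add a c) (A.add b d) := by
  have hδ : ∀ a b : X ⟶ Y, A.add a b =
      A.add (coprod.inl : X ⟶ X ⨿ X) coprod.inr ≫ coprod.desc a b := by
    intro a b
    rw [add_comp, coprod.inl_desc, coprod.inr_desc]
  have hd : coprod.desc (A.add a b) (A.add c d) =
      A.add (coprod.desc a c) (coprod.desc b d) := by
    apply coprod.hom_ext
    · rw [coprod.inl_desc, comp_add, coprod.inl_desc, coprod.inl_desc]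
    · rw [coprod.inr_desc, comp_add, coprod.inr_desc, coprod.inr_desc]
  rw [hδ, hd, comp_add, ← hδ, ← hδ]

/-- The enrichment in commutative monoids determined by an fp-structure on `C_▸`. -/
@[reducible]
def cMonEnriched [HasFiniteCoproducts C] : CMonEnriched C where
  addCommMonoid X Y :=
    -- Eckmann–Hilton is applied with both operations equal to `A.add`.
    have unital : EckmannHilton.IsUnital (A.add (X := X) (Y := Y)) (A.zero X Y) :=
      { left_id := A.zero_add, right_id := A.add_zero }
    { add := A.add
      zero := A.zero X Y
      add_assoc := (EckmannHilton.mul_assoc unital unital A.add_add_add_comm).assoc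
      add_comm := (EckmannHilton.mul_comm unital unital A.add_add_add_comm).comm
      zero_add := A.zero_add
      add_zero := A.add_zero
      nsmul := letI : Add (X ⟶ Y) := ⟨A.add⟩; letI : Zero (X ⟶ Y) := ⟨A.zero X Y⟩; nsmulRec }
  add_comp := A.add_comp
  comp_add := A.comp_add
  zero_comp := A.zero_comp _
  comp_zero f := A.comp_zero f _

/-- On a category with finite biproducts, an fp-structure is determined by its zero arrows. -/
theorem op_eq_of_zero_eq [CMonEnriched C] [HasFiniteBiproducts C] {A B : FpStructure (cone C)}
    (hA : ∀ X Y : C, A.zero X Y = 0) (hB : ∀ X Y : C, B.zero X Y = 0) {n m : ℕ}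
    (p : Fin n → Fin m) {X : Fin n → C} {X' : Fin m → C} (h : ∀ i, X i = X' (p i)) {Y : C}
    (f : ∀ i, X i ⟶ Y) : A.op p h f = B.op p h f := by
  -- The components of the projection `π i` along the injections are identities and zeros, so they
  -- form the image of `𝟙 (X i)` under the mapping `1 → n` that picks `i`.
  have single : ∀ (A : FpStructure (cone C)), (∀ X Y : C, A.zero X Y = 0) → ∀ i,
      (fun i' => biproduct.ι X i' ≫ biproduct.π X i) =
        A.op (n := 1) (fun _ => i) (X := fun _ => X i) (X' := X) (fun _ => rfl)
          (fun _ => 𝟙 (X i)) := by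
    intro A hA i
    funext i'
    by_cases hi : i' = i
    · subst hi
      rw [op_single_self, biproduct.ι_π_self]
    · rw [A.op_single_of_ne _ _ hi, hA, biproduct.ι_π_ne _ hi]
  -- By naturality and functoriality the entry is a component of the action of the mapping `1 → m`
  -- that picks `p i`, hence an identity or a zero.
  have one : ∀ (A : FpStructure (cone C)), (∀ X Y : C, A.zero X Y = 0) → ∀ i j,
      A.op p h (biproduct.ι X) j ≫ biproduct.π X i =
        if hij : p i = j then eqToHom ((congrArg X' hij).symm.trans (h i).symm) else 0 := by
    intro A hA i j
    rw [op_comp, single A hA, op_op]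
    obtain rfl : X = fun i => X' (p i) := funext h
    split_ifs with hij
    · subst hij
      exact A.op_single_self (p i) (𝟙 _)
    · rw [← hA]
      exact A.op_single_of_ne (p i) (𝟙 _) (Ne.symm hij)
  have univ : ∀ j, A.op p h (biproduct.ι X) j = B.op p h (biproduct.ι X) j := by
    intro j
    refine biproduct.hom_ext _ _ fun i => ?_
    rw [one A hA, one B hB]
  funext j
  -- Naturality in the codomain reduces any sequence to the universal cocone.
  have e : f = fun i => biproduct.ι X i ≫ biproduct.desc f :=
    funext fun i => (biproduct.ι_desc f i).symm
  rw [e, ← op_comp, ← op_comp, univ]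

/-- The fp-structure of the cartesian multicategory `C_▸`. -/
def ofCMonEnriched (C : Type u) [Category.{v} C] [CMonEnriched C] : FpStructure (cone C) :=
  { fpCone C with }

theorem ext_act {M : Multicat.{v, u}} {A B : FpStructure M} (h : @A.act = @B.act) : A = B := by
  cases A
  cases B
  congr

/-- The enrichment is built from `A`, so its zeros are those of `A` by definition, and those of the
action by sums are empty sums. Since zeros determine the fp-structure, additions need not be
compared. -/
theorem toCartMulticat_eq [HasFiniteCoproducts C] :
    ∃ _ : CMonEnriched C, A.toCartMulticat = fpCone C := by
  let _ := A.cMonEnriched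
  have : HasFiniteBiproducts C := hasFiniteBiproducts_of_hasFiniteCoproducts
  refine ⟨inferInstance, ?_⟩
  have h0 : ∀ X Y : C, (ofCMonEnriched C).zero X Y = 0 := by
    intro X Y
    change coneAct (C := C) (X := fun _ => X) (X' := fun _ : Fin 1 => X) Fin.elim0
      (fun _ => rfl) (Y := Y) (fun i => i.elim0) 0 = 0
    simp [coneAct]
  refine congrArg toCartMulticat (ext_act (B := ofCMonEnriched C) ?_)
  funext n m p X X' h Y f
  exact op_eq_of_zero_eq (A := A) (B := ofCMonEnriched C) (fun _ _ => rfl) h0 p h f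

end FpStructure

/-- This is the essential surjectivity behind both equivalences. -/
theorem exists_iso_fpCone {M : CartMulticat.{v, u}} (hM : fpSum M) :
    ∃ (C : Type u) (_ : Category.{v} C) (_ : CMonEnriched C) (_ : HasFiniteCoproducts C),
      Nonempty (fpCone C ≅ M) := by
  obtain ⟨⟨C, _, ⟨e⟩⟩, hr⟩ := hM
  have : HasFiniteCoproducts C :=
    hasFiniteCoproducts_of_preUniversal (exists_preUniversal_of_iso e.symm hr)
  obtain ⟨A, ⟨i⟩⟩ := exists_fpStructure_iso (N := M) e.symm
  obtain ⟨_, hA⟩ := A.toCartMulticat_eq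
  exact ⟨C, inferInstance, inferInstance, inferInstance, ⟨eqToIso hA.symm ≪≫ i⟩⟩

/-! ### Comparison of `C_▸` and `C_×` -/

theorem proj_congr {C : Type u} [Category.{v} C] [HasFiniteProducts C] {n : ℕ}
    {X : Fin n → C} {Y : C} {i j : Fin n} (h : i = j) (hi : Y = X i)
    (hj : Y = X j) : proj X i hi = proj X j hj := by
  subst h
  rfl

section Comparison

variable {C : Type u} [Category.{v} C] [CMonEnriched C] [HasFiniteProducts C]

/-- The arrow out of a product given by the sum of a sequence of arrows out of its factors. -/
noncomputable def timesOfCone {n : ℕ} {X : Fin n → C} {Y : C} (f : ∀ i, X i ⟶ Y) : ∏ᶜ X ⟶ Y :=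
  ∑ i, proj X i rfl ≫ f i

/-- The bicone over a finite product in a category enriched in commutative monoids. -/
noncomputable def productBicone {n : ℕ} (X : Fin n → C) : Bicone X where
  pt := ∏ᶜ X
  π := fun i => proj X i rfl
  ι := fun i => Pi.lift fun j => if h : i = j then eqToHom (congrArg X h) else 0
  ι_π := fun i j => by rw [lift_proj, eqToHom_refl, Category.comp_id]; congr

theorem productBicone_total {n : ℕ} (X : Fin n → C) :
    ∑ i, (productBicone X).π i ≫ (productBicone X).ι i = 𝟙 (∏ᶜ X) :=
  pi_ext fun i => (sum_comp_ι_π (productBicone X) _ i).trans (Category.id_comp _).symm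

/-- The components of an arrow out of a product along the injections. -/
noncomputable def coneOfTimes {n : ℕ} {X : Fin n → C} {Y : C} (f : ∏ᶜ X ⟶ Y) (i : Fin n) :
    X i ⟶ Y :=
  (productBicone X).ι i ≫ f

theorem coneOfTimes_timesOfCone {n : ℕ} {X : Fin n → C} {Y : C} (f : ∀ i, X i ⟶ Y) :
    coneOfTimes (timesOfCone f) = f :=
  funext fun i => ι_comp_sum_π (productBicone X) f i

theorem timesOfCone_coneOfTimes {n : ℕ} {X : Fin n → C} {Y : C} (f : ∏ᶜ X ⟶ Y) :
    timesOfCone (coneOfTimes f) = f := by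
  refine Eq.trans ?_ ((congrArg (· ≫ f) (productBicone_total X)).trans (Category.id_comp f))
  refine Eq.trans ?_ (sum_comp _ _ _).symm
  exact Finset.sum_congr rfl fun i _ => (Category.assoc _ _ _).symm

theorem comp_timesOfCone {n : ℕ} {X : Fin n → C} {W Y : C} (u : W ⟶ ∏ᶜ X) (f : ∀ i, X i ⟶ Y) :
    u ≫ timesOfCone f = ∑ i, (u ≫ proj X i rfl) ≫ f i := by
  rw [timesOfCone, comp_sum]
  simp only [Category.assoc]

theorem timesOfCone_id (X : C) :
    timesOfCone (X := fun _ : Fin 1 => X) (fun _ => 𝟙 X) = proj (fun _ : Fin 1 => X) 0 rfl := by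
  simp [timesOfCone]

/-- Both sides are one sum over `Fin n`, grouped on the left by the fibres of `p`. -/
theorem timesOfCone_coneAct {n m : ℕ} (p : Fin n → Fin m) {X : Fin n → C} {X' : Fin m → C}
    (h : ∀ i, X i = X' (p i)) {Y : C} (f : ∀ i, X i ⟶ Y) :
    timesOfCone (coneAct p h f) = reind p h ≫ timesOfCone f := by
  rw [comp_timesOfCone, timesOfCone]
  simp only [coneAct, comp_sum, reind_proj]
  rw [← Fintype.sum_sigma']
  refine Fintype.sum_equiv (Equiv.sigmaFiberEquiv p) _ _ ?_
  rintro ⟨_, i, rfl⟩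
  simp [proj]
  rfl

theorem timesOfCone_comp {n : ℕ} {Y : Fin n → C} {Z : C} {k : Fin n → ℕ}
    {X : ∀ i, Fin (k i) → C} (f : ∀ i, Y i ⟶ Z) (g : ∀ i l, X i l ⟶ Y i) :
    timesOfCone (X := concat X) ((cone C).comp (Y := Y) (Z := Z) (X := X) f g) =
      timesComp (timesOfCone f) (fun i => timesOfCone (g i)) := by
  -- The summand for one pair `(i, l)`; both sides are the sum of these over all pairs.
  let ψ : ∀ s : (Σ i, Fin (k i)), ∏ᶜ (concat X) ⟶ Z := fun s =>
    proj (concat X) (finSigmaFinEquiv s) (concat_apply X s).symm ≫ g s.1 s.2 ≫ f s.1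
  have h1 : timesComp (timesOfCone f) (fun i => timesOfCone (g i)) = ∑ s, ψ s := by
    rw [timesComp, comp_timesOfCone, Fintype.sum_sigma]
    refine Finset.sum_congr rfl fun i _ => ?_
    rw [lift_proj, eqToHom_refl, Category.comp_id, comp_timesOfCone, sum_comp]
    refine Finset.sum_congr rfl fun l _ => ?_
    rw [blockProj, reind_proj, Category.assoc]
  rw [h1, ← Equiv.sum_comp finSigmaFinEquiv.symm]
  refine Finset.sum_congr rfl fun J _ => ?_
  exact congrArg (· ≫ g (finSigmaFinEquiv.symm J).1 (finSigmaFinEquiv.symm J).2 ≫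
    f (finSigmaFinEquiv.symm J).1) (proj_congr (Equiv.apply_symm_apply _ J).symm _ _)

theorem coneOfTimes_id (X : C) :
    coneOfTimes (proj (fun _ : Fin 1 => X) 0 rfl) = fun _ => 𝟙 X := by
  rw [← timesOfCone_id, coneOfTimes_timesOfCone]

theorem coneOfTimes_reind {n m : ℕ} (p : Fin n → Fin m) {X : Fin n → C} {X' : Fin m → C}
    (h : ∀ i, X i = X' (p i)) {Y : C} (f : ∏ᶜ X ⟶ Y) :
    coneOfTimes (reind p h ≫ f) = coneAct p h (coneOfTimes f) := by
  rw [← coneOfTimes_timesOfCone (coneAct p h (coneOfTimes f)), timesOfCone_coneAct,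
    timesOfCone_coneOfTimes]

theorem coneOfTimes_timesComp {n : ℕ} {Y : Fin n → C} {Z : C} {k : Fin n → ℕ}
    {X : ∀ i, Fin (k i) → C} (f : ∏ᶜ Y ⟶ Z) (g : ∀ i, ∏ᶜ (X i) ⟶ Y i) :
    coneOfTimes (timesComp f g) = (cone C).comp (Y := Y) (Z := Z) (X := X) (coneOfTimes f)
      (fun i => coneOfTimes (g i)) := by
  refine Eq.trans ?_ (coneOfTimes_timesOfCone (X := concat X) _)
  rw [timesOfCone_comp]
  simp only [timesOfCone_coneOfTimes]

variable (C) in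
/-- The isomorphism of cartesian multicategories between `C_▸` and `C_×`. -/
noncomputable def fpConeIsoFpTimes : fpCone C ≅ fpTimes C where
  hom :=
    { obj := fun X : C => X
      map := fun {n} {X : Fin n → C} {Y : C} (f : ∀ i, X i ⟶ Y) => timesOfCone f
      map_id := fun X => timesOfCone_id (C := C) X
      map_comp := fun f g => timesOfCone_comp (C := C) f g
      map_act := fun p _ _ h _ f => timesOfCone_coneAct (C := C) p h f }
  inv :=
    { obj := fun X : C => X
      map := fun {n} {X : Fin n → C} {Y : C} (f : ∏ᶜ X ⟶ Y) => coneOfTimes f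
      map_id := fun X => coneOfTimes_id (C := C) X
      map_comp := fun f g => coneOfTimes_timesComp (C := C) f g
      map_act := fun p _ _ h _ f => coneOfTimes_reind (C := C) p h f }
  hom_inv_id := FpFunctor.ext rfl (heq_of_eq (by
    funext n X Y f
    exact coneOfTimes_timesOfCone (C := C) f))
  inv_hom_id := FpFunctor.ext rfl (heq_of_eq (by
    funext n X Y f
    exact timesOfCone_coneOfTimes (C := C) f))

variable {D : Type u} [Category.{v} D] [CMonEnriched D] [HasFiniteProducts D]

theorem comparison_timesOfCone {F : C ⥤ D} (hF : IsAdditive F) [PreservesFiniteProducts F]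
    {n : ℕ} {X : Fin n → C} {Y : C} (f : ∀ i, X i ⟶ Y) :
    comparison F X ≫ F.map (timesOfCone f) =
      timesOfCone (X := fun i => F.obj (X i)) fun i => F.map (f i) := by
  rw [timesOfCone, hF.map_sum, comp_sum]
  refine Finset.sum_congr rfl fun i _ => ?_
  rw [F.map_comp, ← Category.assoc, comparison_proj]

theorem fpConeIsoFpTimes_naturality {F : C ⥤ D} (hF : IsAdditive F)
    (hF' : PreservesFiniteProducts F) :
    (fpConeIsoFpTimes C).hom ≫ fpTimesFunctor.map (X := ⟨C⟩) (Y := ⟨D⟩) ⟨F, hF'⟩ =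
      fpConeFunctor.map (X := ⟨C⟩) (Y := ⟨D⟩) ⟨F, hF⟩ ≫ (fpConeIsoFpTimes D).hom := by
  refine FpFunctor.ext rfl (heq_of_eq ?_)
  funext n X Y f
  exact comparison_timesOfCone (C := C) (D := D) hF f

theorem fpTimesFunctor_map_surjective [HasFiniteCoproducts C] [HasFiniteCoproducts D]
    (K : fpTimes C ⟶ fpTimes D) :
    ∃ (F : C ⥤ D) (hF : PreservesFiniteProducts F),
      fpTimesFunctor.map (X := ⟨C⟩) (Y := ⟨D⟩) ⟨F, hF⟩ = K := by
  obtain ⟨⟨F, hF⟩, h⟩ := fpConeFunctor.map_surjective (X := CMonCat.mk C) (Y := CMonCat.mk D)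
    (show fpCone C ⟶ fpCone D from
      (fpConeIsoFpTimes C).hom ≫ K ≫ (fpConeIsoFpTimes D).inv)
  -- Conjugating `K` by the isomorphisms `C_▸ ≅ C_×` brings in fullness for `C_▸`; the additive
  -- functor so found preserves products.
  have hF' : PreservesFiniteProducts F := ((additive_functor_tfae F).out 0 2).1 hF
  refine ⟨F, hF', (cancel_epi (fpConeIsoFpTimes C).hom).1 ?_⟩
  refine (fpConeIsoFpTimes_naturality hF hF').trans ?_
  refine (congrArg (· ≫ (fpConeIsoFpTimes D).hom) h).trans ?_
  exact (show ((fpConeIsoFpTimes C).hom ≫ K ≫ (fpConeIsoFpTimes D).inv) ≫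
    (fpConeIsoFpTimes D).hom = (fpConeIsoFpTimes C).hom ≫ K by simp)

theorem fpTimesFunctor_map_injective [HasFiniteCoproducts C] [HasFiniteCoproducts D]
    {F G : C ⥤ D} (hF : PreservesFiniteProducts F) (hG : PreservesFiniteProducts G)
    (h : fpTimesFunctor.map (X := ⟨C⟩) (Y := ⟨D⟩) ⟨F, hF⟩ =
      fpTimesFunctor.map (X := ⟨C⟩) (Y := ⟨D⟩) ⟨G, hG⟩) : F = G := by
  have aF : IsAdditive F := ((additive_functor_tfae F).out 0 2).2 hF
  have aG : IsAdditive G := ((additive_functor_tfae G).out 0 2).2 hG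
  have e : fpConeFunctor.map (X := ⟨C⟩) (Y := ⟨D⟩) ⟨F, aF⟩ =
      fpConeFunctor.map (X := ⟨C⟩) (Y := ⟨D⟩) ⟨G, aG⟩ := by
    refine (cancel_mono (fpConeIsoFpTimes D).hom).1 ?_
    refine (fpConeIsoFpTimes_naturality aF hF).symm.trans (Eq.trans ?_
      (fpConeIsoFpTimes_naturality aG hG))
    exact congrArg _ h
  exact congrArg Subtype.val (fpConeFunctor.map_injective e)

end Comparison

/-! ### The two equivalences. -/

theorem fpSum_fpTimes (C : Type u) [Category.{v} C] [HasFiniteProducts C]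
    (h : HasNaturallyIsoSumsProducts C) : fpSum (fpTimes C) := by
  obtain ⟨_⟩ := h.exists_cMonEnriched
  have := h.1
  let e := underlying.mapIso (fpConeIsoFpTimes C).symm
  exact ⟨⟨C, inferInstance, ⟨e⟩⟩, isRepresentable_of_iso e cone_isRepresentable⟩

theorem fpConeFunctor_lift_isEquivalence (h : ∀ C : hasSums.{v, u}.FullSubcategory,
      fpSum.{v, u} ((hasSums.{v, u}.ι ⋙ fpConeFunctor.{v, u}).obj C)) :
    (fpSum.{v, u}.lift (hasSums.{v, u}.ι ⋙ fpConeFunctor.{v, u}) h).IsEquivalence where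
  -- Fullness and faithfulness are inherited from `fpConeFunctor` by instance inference.
  essSurj := ⟨fun M => by
    obtain ⟨C, _, _, hC, ⟨i⟩⟩ := exists_iso_fpCone M.property
    exact ⟨⟨⟨C⟩, hC⟩, ⟨fpSum.isoMk i⟩⟩⟩

theorem fpTimesFunctor_lift_isEquivalence (h : ∀ C : sumsIsoProducts.{v, u}.FullSubcategory,
      fpSum.{v, u} ((sumsIsoProducts.{v, u}.ι ⋙ fpTimesFunctor.{v, u}).obj C)) :
    (fpSum.{v, u}.lift (sumsIsoProducts.{v, u}.ι ⋙ fpTimesFunctor.{v, u}) h).IsEquivalence where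
  faithful := ⟨fun {C D} F G hFG => by
    -- The enrichments are auxiliary choices: the claim about product preserving functors does not
    -- mention them.
    obtain ⟨_⟩ := C.property.exists_cMonEnriched
    obtain ⟨_⟩ := D.property.exists_cMonEnriched
    have := C.property.1
    have := D.property.1
    exact ObjectProperty.hom_ext _ (Subtype.ext (fpTimesFunctor_map_injective F.hom.2 G.hom.2
      (fpSum.ι.congr_map hFG)))⟩
  full := ⟨fun {C D} K => by
    obtain ⟨_⟩ := C.property.exists_cMonEnriched
    obtain ⟨_⟩ := D.property.exists_cMonEnriched
    have := C.property.1
    have := D.property.1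
    obtain ⟨F, hF, e⟩ := fpTimesFunctor_map_surjective (C := C.obj.carrier) (D := D.obj.carrier)
      K.hom
    exact ⟨ObjectProperty.homMk ⟨F, hF⟩, ObjectProperty.hom_ext _ e⟩⟩
  essSurj := ⟨fun M => by
    obtain ⟨C, _, _, _, ⟨i⟩⟩ := exists_iso_fpCone M.property
    have : HasFiniteBiproducts C := hasFiniteBiproducts_of_hasFiniteCoproducts
    exact ⟨⟨⟨C⟩, hasNaturallyIsoSumsProducts_of_hasFiniteBiproducts⟩,
      ⟨fpSum.isoMk ((fpConeIsoFpTimes C).symm ≪≫ i)⟩⟩⟩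

end CartMulti

open CategoryTheory CategoryTheory.Limits CartMulti in
theorem mainTheorem7 :
    -- preadditive categories with finite sums and additive functors
    (∃ h : ∀ C : hasSums.{v, u}.FullSubcategory,
        fpSum.{v, u} ((hasSums.{v, u}.ι ⋙ fpConeFunctor.{v, u}).obj C),
      (fpSum.{v, u}.lift (hasSums.{v, u}.ι ⋙ fpConeFunctor.{v, u}) h).IsEquivalence) ∧
    -- categories with naturally isomorphic finite sums and products, product preserving functors
    (∃ h : ∀ C : sumsIsoProducts.{v, u}.FullSubcategory,
        fpSum.{v, u} ((sumsIsoProducts.{v, u}.ι ⋙ fpTimesFunctor.{v, u}).obj C),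
      (fpSum.{v, u}.lift (sumsIsoProducts.{v, u}.ι ⋙ fpTimesFunctor.{v, u}) h).IsEquivalence) ∧
    -- the two characterizations of additive categories
    (∀ (C : Type u) [Category.{v} C],
      List.TFAE [∃ _ : CMonEnriched C, HasFiniteBiproducts C,
        ∃ _ : CMonEnriched C, HasFiniteCoproducts C,
        HasNaturallyIsoSumsProducts C]) ∧
    -- and of the functors between them
    (∀ (C D : Type u) [Category.{v} C] [Category.{v} D] [CMonEnriched C] [CMonEnriched D]
      [HasFiniteCoproducts C] [HasFiniteCoproducts D] (F : C ⥤ D),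
      List.TFAE [IsAdditive F, PreservesBiproducts F, PreservesFiniteProducts F,
        PreservesFiniteCoproducts F]) := by
  exact ⟨⟨fun C => have : HasFiniteCoproducts C.obj.carrier := C.property
      fpSum_fpCone C.obj.carrier, fpConeFunctor_lift_isEquivalence _⟩,
    ⟨fun C => fpSum_fpTimes C.obj.carrier C.property, fpTimesFunctor_lift_isEquivalence _⟩,
    fun C _ => additive_category_tfae C,
    fun _ _ _ _ _ _ _ _ F => additive_functor_tfae F⟩
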